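/- Let $N\ge 3$ and let $D^{1,2}(\mathbb R^N)$ be the completion of $C_c^\infty(\mathbb R^N)$ in the norm $\big(\int_{\mathbb R^N}|\nabla u|^2\,dx\big)^{1/2}$, regarded as a space of functions. For a function $q\in L^\infty(\mathbb R^N)$ put $$\Lambda(q)=\inf\left\{\frac{\int_{\mathbb R^N}|\nabla u|^2\,dx}{\int_{\mathbb R^N}\frac{q(x)}{|x|^2}u^2\,dx}\;:\;u\in D^{1,2}(\mathbb R^N),\ \int_{\mathbb R^N}\frac{q(x)}{|x|^2}u^2\,dx>0\right\},\qquad \inf\emptyset=+\infty .$$ Let $m\in L^\infty(\mathbb R^N)$ be real-valued and let $\gamma_+>1$, $\gamma_->1$. Suppose that the limits $$m_+(x)=\lim_{j\to\infty}m(\gamma_+^{\,j}x),\qquad m_-(x)=\lim_{j\to\infty}m(\gamma_-^{-j}x)\qquad(j\in\mathbb N)$$ exist for almost every $x\in\mathbb R^N$, that the first convergence is uniform (up to null sets) on $\{x:|x|\ge R\}$ for every $R>0$, and that the second is uniform (up to null sets) on $\{x:|x|\le\rho\}$ for every $\rho>0$. Put $\Lambda_m=\Lambda(m)$ and $\Lambda_\pm=\Lambda(m_\pm)$.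 If $$\Lambda_m<\min(\Lambda_+,\Lambda_-),$$ then $\Lambda_m$ is attained: there is $u\in D^{1,2}(\mathbb R^N)$ with $\int_{\mathbb R^N}\frac{m(x)}{|x|^2}u^2\,dx>0$ and $$\frac{\int_{\mathbb R^N}|\nabla u|^2\,dx}{\int_{\mathbb R^N}\frac{m(x)}{|x|^2}u^2\,dx}=\Lambda_m .$$ -/

import Mathlib

open MeasureTheory Filter Topology
open scoped ContDiff ENNReal

/-- The Sobolev space `D^{1,2}(ℝ^N)`, `N ≥ 3`: the completion of `C_c^∞(ℝ^N)` in the norm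
`(∫ |∇φ|²)^{1/2}`. By the Sobolev inequality a sequence of test functions that is Cauchy in this norm
is also Cauchy in `L^{2*}`, `2* = 2N/(N-2)`, so the completion is the closure of the
pairs `(φ, ∇φ)`, `φ ∈ C_c^∞`, in `L^{2*} × L²`. An element is a function `u` together with `∇u`; the
latter is the distributional gradient of `u`, hence is determined by `u` almost everywhere. -/
structure D12 (N : ℕ) where
  /-- the function `u` (a representative) -/
  toFun : EuclideanSpace ℝ (Fin N) → ℝ
  /-- its gradient `∇u` (a representative) -/
  grad : EuclideanSpace ℝ (Fin N) → EuclideanSpace ℝ (Fin N)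
  memLp_toFun : MemLp toFun (ENNReal.ofReal (2 * (N : ℝ) / ((N : ℝ) - 2))) volume
  memLp_grad : MemLp grad 2 volume
  exists_approx : ∃ φ : ℕ → EuclideanSpace ℝ (Fin N) → ℝ,
    (∀ k, ContDiff ℝ ∞ (φ k) ∧ HasCompactSupport (φ k)) ∧
    Tendsto (fun k => eLpNorm (fun x => φ k x - toFun x)
      (ENNReal.ofReal (2 * (N : ℝ) / ((N : ℝ) - 2))) volume) atTop (𝓝 0) ∧
    Tendsto (fun k => eLpNorm (fun x => gradient (φ k) x - grad x) 2 volume) atTop (𝓝 0)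

/-- `∫ |∇u|² dx`. -/
noncomputable def dirichletEnergy {N : ℕ} (u : D12 N) : ℝ :=
  ∫ x, ‖u.grad x‖ ^ 2

/-- `∫ (m(x) / |x|²) u² dx`. For `N ≥ 3` and bounded `m` the integral converges, by Hardy's
inequality. -/
noncomputable def hardyForm {N : ℕ} (m : EuclideanSpace ℝ (Fin N) → ℝ) (u : D12 N) : ℝ :=
  ∫ x, m x / ‖x‖ ^ 2 * u.toFun x ^ 2

/-- `Λ_m`, the infimum of `∫ |∇u|² / ∫ (m / |x|²) u²` over those `u ∈ D^{1,2}(ℝ^N)` for which the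
denominator is positive (so `u ≠ 0`); it is `+∞` if there is no such `u`. -/
noncomputable def hardyInf {N : ℕ} (m : EuclideanSpace ℝ (Fin N) → ℝ) : EReal :=
  ⨅ (u : D12 N) (_ : 0 < hardyForm m u), ((dirichletEnergy u / hardyForm m u : ℝ) : EReal)

/-!
The infimum is attained because a minimizing sequence can lose compactness only by concentrating at
the origin or by escaping to infinity, and there `m` looks like `m_-` or `m_+`, whose infima are
strictly larger.

Write `E(u) = ∫ |∇u|²` and `B(u) = ∫ (m / |x|²) u²`. Hardy's inequality
(`IsTestFunction.eLpNorm_div_norm_le`) makes `B` continuous on `D^{1,2}`, so there is a minimizing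
sequence of test functions `f k` with `B(f k) = 1` and `E(f k) → Λ`
(`exists_minimizing_sequence`). No weak limit is needed. The form `Q = E - Λ B` is nonnegative and
`Q(f k) → 0`, so by the parallelogram law `Q(f j - f k) → 0`; it remains to see that `Q` controls
`E` on differences.

* The limits `m_±` are invariant under the dilations that define them
  (`ae_eq_of_tendsto_dilation`), hence `m - m_-` tends to zero at the origin and `m - m_+` at
  infinity. Cutting off near these two ends gives, for a real `t` with `Λ < t < min(Λ_+, Λ_-)`,
  `t B(w) ≤ (1 + δ) E(w) + C ∫_{|x| ≤ R} w²` (`exists_mul_testForm_le`).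
* The last integral is at most `η E(w)` plus a multiple of the squares of finitely many averages of
  `w`, for every `η > 0` (`exists_finset_integral_sq_le`). This takes the place of Rellich's theorem
  and rests on the `L²`-continuity of translations.
* Along a subsequence the finitely many averages converge, so `E(f j - f k) → 0`
  (`exists_subseq_testEnergy_cauchy`).

By the Sobolev inequality the subsequence converges in `D^{1,2}` (`D12.exists_approx_of_cauchy`),
and its limit `u` has `B(u) = 1` and `E(u) = Λ`.
-/

/-! ### Square-integrable functions -/

theorem MeasureTheory.MemLp.eLpNorm_two_eq_ofReal_sqrt {α F : Type*} [MeasurableSpace α]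
    {μ : Measure α} [NormedAddCommGroup F] {f : α → F} (hf : MemLp f 2 μ) :
    eLpNorm f 2 μ = ENNReal.ofReal (√(∫ x, ‖f x‖ ^ 2 ∂μ)) := by
  rw [hf.eLpNorm_eq_integral_rpow_norm two_ne_zero ENNReal.ofNat_ne_top, Real.sqrt_eq_rpow]
  norm_num

/-- The quadratic functional `f ↦ ∫ m f²` with bounded weight `m` is continuous on `L²`. -/
theorem tendsto_integral_mul_sq {α : Type*} [MeasurableSpace α] {μ : Measure α} {m : α → ℝ}
    (hm : MemLp m ∞ μ) {f : ℕ → α → ℝ} {g : α → ℝ} (hf : ∀ k, MemLp (f k) 2 μ)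
    (hg : MemLp g 2 μ) (hfg : Tendsto (fun k => eLpNorm (fun x => f k x - g x) 2 μ) atTop (𝓝 0)) :
    Tendsto (fun k => ∫ x, m x * f k x ^ 2 ∂μ) atTop (𝓝 (∫ x, m x * g x ^ 2 ∂μ)) := by
  have hmf : ∀ h : α → ℝ, MemLp h 2 μ → Integrable (fun x => m x * h x ^ 2) μ := fun h hh =>
    hh.integrable_sq.mul_of_top_right hm
  have hbound : Tendsto (fun k => eLpNorm m ∞ μ * (eLpNorm (fun x => f k x - g x) 2 μ *
      (eLpNorm (fun x => f k x - g x) 2 μ + 2 * eLpNorm g 2 μ))) atTop (𝓝 0) := by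
    have h1 : Tendsto (fun k => eLpNorm (fun x => f k x - g x) 2 μ + 2 * eLpNorm g 2 μ) atTop
        (𝓝 (0 + 2 * eLpNorm g 2 μ)) := hfg.add tendsto_const_nhds
    have hfin : 2 * eLpNorm g 2 μ ≠ ⊤ := ENNReal.mul_ne_top (by simp) hg.eLpNorm_ne_top
    have h2 := ENNReal.Tendsto.mul hfg (by right; simpa using hfin) h1 (by right; simp)
    have h3 := ENNReal.Tendsto.const_mul (a := eLpNorm m ∞ μ) h2 (by right; exact hm.eLpNorm_ne_top)
    simpa using h3
  refine tendsto_integral_of_L1 _ (hmf g hg).1 (Eventually.of_forall fun k => hmf _ (hf k)) ?_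
  refine tendsto_of_tendsto_of_tendsto_of_le_of_le tendsto_const_nhds hbound (fun _ => zero_le)
    fun k => ?_
  have hd : MemLp (fun x => f k x - g x) 2 μ := (hf k).sub hg
  have hs : MemLp (fun x => f k x + g x) 2 μ := (hf k).add hg
  have hcalc : (fun x => m x * f k x ^ 2 - m x * g x ^ 2) =
      m • ((fun x => f k x - g x) • (fun x => f k x + g x)) := by
    funext x; simp; ring
  calc ∫⁻ x, ‖m x * f k x ^ 2 - m x * g x ^ 2‖ₑ ∂μ
      = eLpNorm (m • ((fun x => f k x - g x) • (fun x => f k x + g x))) 1 μ := by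
        rw [← hcalc, eLpNorm_one_eq_lintegral_enorm]
    _ ≤ eLpNorm m ∞ μ * eLpNorm ((fun x => f k x - g x) • (fun x => f k x + g x)) 1 μ :=
        eLpNorm_smul_le_mul_eLpNorm (hs.smul (r := 1) hd).1 hm.1
    _ ≤ eLpNorm m ∞ μ * (eLpNorm (fun x => f k x - g x) 2 μ *
          eLpNorm (fun x => f k x + g x) 2 μ) := by
        gcongr; exact eLpNorm_smul_le_mul_eLpNorm hs.1 hd.1
    _ ≤ _ := by
        gcongr
        have : (fun x => f k x + g x) = (fun x => f k x - g x) + (fun x => 2 * g x) := by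
          funext x; simp; ring
        rw [this]
        refine (eLpNorm_add_le hd.1 (hg.const_mul 2).1 (by norm_num)).trans ?_
        gcongr
        have := eLpNorm_const_smul_le (c := (2 : ℝ)) (f := g) (p := 2) (μ := μ)
        have e : ‖(2 : ℝ)‖ₑ = 2 := by
          rw [Real.enorm_eq_ofReal (by norm_num)]; simp
        rw [e] at this
        exact this

/-! ### Test functions and their Dirichlet energy -/

/-- `φ ∈ C_c^∞(V)`. -/
structure IsTestFunction {V : Type*} [NormedAddCommGroup V] [NormedSpace ℝ V] (φ : V → ℝ) :
    Prop where
  contDiff : ContDiff ℝ ∞ φ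
  hasCompactSupport : HasCompactSupport φ

namespace IsTestFunction

section Algebra

variable {V : Type*} [NormedAddCommGroup V] [NormedSpace ℝ V] {φ ψ η : V → ℝ}

theorem add (hφ : IsTestFunction φ) (hψ : IsTestFunction ψ) :
    IsTestFunction (fun x => φ x + ψ x) :=
  ⟨hφ.contDiff.add hψ.contDiff, hφ.hasCompactSupport.add hψ.hasCompactSupport⟩

theorem mul_left (hφ : IsTestFunction φ) (hη : ContDiff ℝ ∞ η) :
    IsTestFunction (fun x => η x * φ x) :=
  ⟨hη.mul hφ.contDiff, hφ.hasCompactSupport.mul_left⟩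

theorem const_mul (hφ : IsTestFunction φ) (c : ℝ) : IsTestFunction (fun x => c * φ x) :=
  hφ.mul_left contDiff_const

theorem sub (hφ : IsTestFunction φ) (hψ : IsTestFunction ψ) :
    IsTestFunction (fun x => φ x - ψ x) := by
  simpa [sub_eq_add_neg] using hφ.add (hψ.const_mul (-1))

theorem continuous (hφ : IsTestFunction φ) : Continuous φ := hφ.contDiff.continuous

theorem differentiable (hφ : IsTestFunction φ) : Differentiable ℝ φ :=
  hφ.contDiff.differentiable (by simp)

theorem continuous_fderiv (hφ : IsTestFunction φ) : Continuous (fderiv ℝ φ) :=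
  hφ.contDiff.continuous_fderiv (by simp)

theorem fderiv_sub (hφ : IsTestFunction φ) (hψ : IsTestFunction ψ) (x : V) :
    fderiv ℝ (fun x => φ x - ψ x) x = fderiv ℝ φ x - fderiv ℝ ψ x :=
  fderiv_fun_sub (hφ.differentiable x) (hψ.differentiable x)

end Algebra

section Integrability

variable {V : Type*} [NormedAddCommGroup V] [NormedSpace ℝ V]
  [MeasurableSpace V] [BorelSpace V] {μ : Measure V} [IsFiniteMeasureOnCompacts μ] {φ : V → ℝ}

theorem memLp (hφ : IsTestFunction φ) (p : ℝ≥0∞) : MemLp φ p μ :=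
  hφ.continuous.memLp_of_hasCompactSupport hφ.hasCompactSupport

theorem memLp_fderiv (hφ : IsTestFunction φ) (p : ℝ≥0∞) : MemLp (fderiv ℝ φ) p μ :=
  hφ.continuous_fderiv.memLp_of_hasCompactSupport (hφ.hasCompactSupport.fderiv (𝕜 := ℝ))

theorem integrable_mul (hφ : IsTestFunction φ) {g : V → ℝ} (hg : Continuous g) :
    Integrable (fun x => φ x * g x) μ :=
  (hφ.continuous.mul hg).integrable_of_hasCompactSupport hφ.hasCompactSupport.mul_right

theorem integrable_fderiv_sq (hφ : IsTestFunction φ) :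
    Integrable (fun x => ‖fderiv ℝ φ x‖ ^ 2) μ := by
  refine (hφ.continuous_fderiv.norm.pow 2).integrable_of_hasCompactSupport ?_
  have h : HasCompactSupport (fderiv ℝ φ) := hφ.hasCompactSupport.fderiv (𝕜 := ℝ)
  exact h.mono fun x hx h0 => hx (by simp [h0])

end Integrability

end IsTestFunction

/-- The Dirichlet energy `∫ |Dφ|²`, for functions given pointwise. -/
noncomputable def testEnergy {V : Type*} [NormedAddCommGroup V] [NormedSpace ℝ V]
    [MeasureSpace V] (φ : V → ℝ) : ℝ :=
  ∫ x, ‖fderiv ℝ φ x‖ ^ 2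

theorem testEnergy_nonneg {V : Type*} [NormedAddCommGroup V] [NormedSpace ℝ V]
    [MeasureSpace V] (φ : V → ℝ) : 0 ≤ testEnergy φ := integral_nonneg fun _ => by positivity

/-! ### Hardy's inequality -/

section Hardy

variable {V : Type*} [NormedAddCommGroup V] [InnerProductSpace ℝ V] [FiniteDimensional ℝ V]
  [MeasureSpace V] [BorelSpace V] {φ : V → ℝ}

/-- Integration by parts against the regularized radial field `x / (|x|² + ε)`. -/
theorem IsTestFunction.integral_div_radial [(volume : Measure V).IsAddHaarMeasure]
    (hφ : IsTestFunction φ) {ε : ℝ} (hε : 0 < ε) :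
    ∫ x, φ x ^ 2 * (Module.finrank ℝ V / (‖x‖ ^ 2 + ε) - 2 * ‖x‖ ^ 2 / (‖x‖ ^ 2 + ε) ^ 2) =
      -∫ x, 2 * φ x * fderiv ℝ φ x x / (‖x‖ ^ 2 + ε) := by
  set b := stdOrthonormalBasis ℝ V
  have hs : ∀ x : V, ‖x‖ ^ 2 + ε ≠ 0 := fun x => by positivity
  have hφ2 : IsTestFunction (fun x => φ x ^ 2) := by
    simpa [sq] using hφ.mul_left hφ.contDiff
  have hdφ2 : ∀ x v, fderiv ℝ (fun x => φ x ^ 2) x v = 2 * φ x * fderiv ℝ φ x v := fun x v => by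
    rw [((hφ.differentiable x).hasFDerivAt.pow 2).fderiv]
    simp
  let F : Fin (Module.finrank ℝ V) → V → ℝ := fun i x => inner ℝ (b i) x / (‖x‖ ^ 2 + ε)
  have hFdiff : ∀ i, ContDiff ℝ ∞ (F i) := fun i =>
    (contDiff_const.inner ℝ contDiff_id).div ((contDiff_norm_sq ℝ).add contDiff_const) hs
  have hF' : ∀ i x, fderiv ℝ (F i) x (b i) =
      1 / (‖x‖ ^ 2 + ε) - 2 * (inner ℝ (b i) x) ^ 2 / (‖x‖ ^ 2 + ε) ^ 2 := fun i x => by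
    have h1 : HasFDerivAt (fun x : V => inner ℝ (b i) x) (innerSL ℝ (b i)) x :=
      (innerSL ℝ (b i)).hasFDerivAt
    have h2 : HasFDerivAt (fun x : V => ‖x‖ ^ 2 + ε) (2 • (innerSL ℝ x)) x :=
      ((hasStrictFDerivAt_norm_sq x).hasFDerivAt).add_const ε
    have h3 := h1.mul ((hasDerivAt_inv (hs x)).comp_hasFDerivAt x h2)
    rw [show fderiv ℝ (F i) x = _ from h3.fderiv]
    have := hs x
    simp [real_inner_comm]
    field_simp
    ring
  have hparts : ∀ i, ∫ x, φ x ^ 2 * fderiv ℝ (F i) x (b i) =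
      -∫ x, fderiv ℝ (fun x => φ x ^ 2) x (b i) * F i x := fun i => by
    have hcd : Continuous (fun x => fderiv ℝ (F i) x (b i)) :=
      ((hFdiff i).continuous_fderiv (by simp)).clm_apply continuous_const
    refine integral_mul_fderiv_eq_neg_fderiv_mul_of_integrable ?_ ?_ ?_ ?_ ?_
    · refine Continuous.integrable_of_hasCompactSupport
        ((hφ2.continuous_fderiv.clm_apply continuous_const).mul (hFdiff i).continuous) ?_
      exact (hφ2.hasCompactSupport.fderiv_apply (𝕜 := ℝ) (b i)).mul_right
    · exact hφ2.integrable_mul hcd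
    · exact hφ2.integrable_mul (hFdiff i).continuous
    · exact fun x _ => hφ2.differentiable x
    · exact fun x _ => (hFdiff i).differentiable (by simp) x
  have hsumL : ∫ x, φ x ^ 2 * (Module.finrank ℝ V / (‖x‖ ^ 2 + ε) -
      2 * ‖x‖ ^ 2 / (‖x‖ ^ 2 + ε) ^ 2) = ∑ i, ∫ x, φ x ^ 2 * fderiv ℝ (F i) x (b i) := by
    rw [← integral_finsetSum]
    · congr 1; funext x
      rw [← Finset.mul_sum]
      simp only [hF', Finset.sum_sub_distrib, ← Finset.sum_div, ← Finset.mul_sum]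
      rw [b.sum_sq_inner_right x]
      simp
    · intro i _
      exact hφ2.integrable_mul (((hFdiff i).continuous_fderiv (by simp)).clm_apply continuous_const)
  have hsumR : ∫ x, 2 * φ x * fderiv ℝ φ x x / (‖x‖ ^ 2 + ε) =
      ∑ i, ∫ x, fderiv ℝ (fun x => φ x ^ 2) x (b i) * F i x := by
    rw [← integral_finsetSum]
    · congr 1; funext x
      have hx : fderiv ℝ φ x x = ∑ i, inner ℝ (b i) x * fderiv ℝ φ x (b i) := by
        conv_lhs => arg 2; rw [← b.sum_repr' x]
        simp
      rw [hx, Finset.mul_sum, Finset.sum_div]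
      refine Finset.sum_congr rfl fun i _ => ?_
      rw [hdφ2]
      simp only [F]
      ring
    · intro i _
      refine Continuous.integrable_of_hasCompactSupport
        ((hφ2.continuous_fderiv.clm_apply continuous_const).mul (hFdiff i).continuous) ?_
      exact (hφ2.hasCompactSupport.fderiv_apply (𝕜 := ℝ) (b i)).mul_right
  rw [hsumL, hsumR, ← Finset.sum_neg_distrib]
  exact Finset.sum_congr rfl fun i _ => hparts i

/-- Hardy's inequality with a regularized weight. The constant `4` is sharp only in dimension `3`. -/
theorem IsTestFunction.integral_sq_div_norm_sq_add_le [(volume : Measure V).IsAddHaarMeasure]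
    (hV : 3 ≤ Module.finrank ℝ V)
    (hφ : IsTestFunction φ) {ε : ℝ} (hε : 0 < ε) :
    ∫ x, φ x ^ 2 / (‖x‖ ^ 2 + ε) ≤ 4 * testEnergy φ := by
  have hs : ∀ x : V, 0 < ‖x‖ ^ 2 + ε := fun x => by positivity
  have hφ2 : IsTestFunction (fun x => φ x ^ 2) := by
    simpa [sq] using hφ.mul_left hφ.contDiff
  have hI : Integrable (fun x => φ x ^ 2 / (‖x‖ ^ 2 + ε)) :=
    hφ2.integrable_mul (g := fun x => (‖x‖ ^ 2 + ε)⁻¹)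
      (Continuous.inv₀ (by fun_prop) fun x => (hs x).ne')
  have h1 : ∫ x, φ x ^ 2 / (‖x‖ ^ 2 + ε) ≤
      ∫ x, φ x ^ 2 * (Module.finrank ℝ V / (‖x‖ ^ 2 + ε) -
        2 * ‖x‖ ^ 2 / (‖x‖ ^ 2 + ε) ^ 2) := by
    refine integral_mono hI (hφ2.integrable_mul (Continuous.sub
      (Continuous.div (by fun_prop) (by fun_prop) fun x => (hs x).ne')
      (Continuous.div (by fun_prop) (by fun_prop) fun x => (pow_pos (hs x) 2).ne'))) fun x => ?_
    have hV' : (3 : ℝ) ≤ Module.finrank ℝ V := by exact_mod_cast hV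
    have : 1 / (‖x‖ ^ 2 + ε) ≤ Module.finrank ℝ V / (‖x‖ ^ 2 + ε) -
        2 * ‖x‖ ^ 2 / (‖x‖ ^ 2 + ε) ^ 2 := by
      have e : Module.finrank ℝ V / (‖x‖ ^ 2 + ε) - 2 * ‖x‖ ^ 2 / (‖x‖ ^ 2 + ε) ^ 2 -
          1 / (‖x‖ ^ 2 + ε) = ((Module.finrank ℝ V - 1) * (‖x‖ ^ 2 + ε) - 2 * ‖x‖ ^ 2) /
            (‖x‖ ^ 2 + ε) ^ 2 := by
        have := (hs x).ne'
        field_simp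
        ring
      have : 0 ≤ ((Module.finrank ℝ V - 1) * (‖x‖ ^ 2 + ε) - 2 * ‖x‖ ^ 2) /
            (‖x‖ ^ 2 + ε) ^ 2 := by
        apply div_nonneg _ (by positivity)
        nlinarith [hs x, sq_nonneg ‖x‖]
      linarith
    calc φ x ^ 2 / (‖x‖ ^ 2 + ε) = φ x ^ 2 * (1 / (‖x‖ ^ 2 + ε)) := by ring
      _ ≤ _ := mul_le_mul_of_nonneg_left this (sq_nonneg _)
  -- The weights in Young's inequality are chosen so that half of the left-hand side is absorbed.
  have h2 : -∫ x, 2 * φ x * fderiv ℝ φ x x / (‖x‖ ^ 2 + ε) ≤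
      ∫ x, (1 / 2 * (φ x ^ 2 / (‖x‖ ^ 2 + ε)) + 2 * ‖fderiv ℝ φ x‖ ^ 2) := by
    rw [← integral_neg]
    refine integral_mono ?_ ((hI.const_mul _).add (hφ.integrable_fderiv_sq.const_mul _))
      fun x => ?_
    · have := hφ.integrable_mul (μ := volume)
        (g := fun x => -(2 * fderiv ℝ φ x x / (‖x‖ ^ 2 + ε)))
        (Continuous.neg (Continuous.div
          (continuous_const.mul (hφ.continuous_fderiv.clm_apply continuous_id)) (by fun_prop)
          fun x => (hs x).ne'))
      convert this using 2 with x
      ring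
    · have hD : |fderiv ℝ φ x x| ≤ ‖fderiv ℝ φ x‖ * ‖x‖ := (fderiv ℝ φ x).le_opNorm x
      have hx := hs x
      have e : 1 / 2 * (φ x ^ 2 / (‖x‖ ^ 2 + ε)) + 2 * ‖fderiv ℝ φ x‖ ^ 2 -
          -(2 * φ x * fderiv ℝ φ x x / (‖x‖ ^ 2 + ε)) =
          (1 / 2 * φ x ^ 2 + 2 * ‖fderiv ℝ φ x‖ ^ 2 * (‖x‖ ^ 2 + ε) +
            2 * φ x * fderiv ℝ φ x x) / (‖x‖ ^ 2 + ε) := by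
        have := hx.ne'
        field_simp
        ring
      have hD2 : (fderiv ℝ φ x x) ^ 2 ≤ ‖fderiv ℝ φ x‖ ^ 2 * ‖x‖ ^ 2 := by
        rw [← mul_pow, ← sq_abs]; gcongr
      have : 0 ≤ (1 / 2 * φ x ^ 2 + 2 * ‖fderiv ℝ φ x‖ ^ 2 * (‖x‖ ^ 2 + ε) +
            2 * φ x * fderiv ℝ φ x x) / (‖x‖ ^ 2 + ε) := by
        apply div_nonneg _ hx.le
        nlinarith [sq_nonneg (φ x + 2 * fderiv ℝ φ x x), sq_nonneg ‖fderiv ℝ φ x‖,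
          mul_nonneg (sq_nonneg ‖fderiv ℝ φ x‖) hε.le]
      linarith
  rw [integral_add (hI.const_mul _) (hφ.integrable_fderiv_sq.const_mul _), integral_const_mul,
    integral_const_mul] at h2
  have h3 := hφ.integral_div_radial hε
  unfold testEnergy
  linarith

/-- **Hardy's inequality** for test functions, in `L²`-norm form. -/
theorem IsTestFunction.eLpNorm_div_norm_le [(volume : Measure V).IsAddHaarMeasure]
    (hV : 3 ≤ Module.finrank ℝ V) (hφ : IsTestFunction φ) :
    eLpNorm (fun x => φ x / ‖x‖) 2 volume ≤ 2 * eLpNorm (fderiv ℝ φ) 2 volume := by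
  have hs : ∀ (n : ℕ) (x : V), 0 < ‖x‖ ^ 2 + 1 / ((n : ℝ) + 1) := fun n x => by positivity
  have hcont : ∀ n : ℕ, Continuous (fun x : V => (√(‖x‖ ^ 2 + 1 / ((n : ℝ) + 1)))⁻¹) := fun n =>
    Continuous.inv₀ (by fun_prop) fun x => (Real.sqrt_pos.2 (hs n x)).ne'
  have hmem : ∀ n : ℕ, MemLp (fun x => φ x / √(‖x‖ ^ 2 + 1 / ((n : ℝ) + 1))) 2 volume :=
    fun n => (hφ.continuous.mul (hcont n)).memLp_of_hasCompactSupport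
      hφ.hasCompactSupport.mul_right
  have hlim : ∀ᵐ x : V, Tendsto (fun n : ℕ => φ x / √(‖x‖ ^ 2 + 1 / ((n : ℝ) + 1))) atTop
      (𝓝 (φ x / ‖x‖)) := by
    have : Nontrivial V := Module.nontrivial_of_finrank_pos (R := ℝ) (by omega)
    -- At the origin `φ x / ‖x‖` has the junk value `0`, and the convergence may fail.
    filter_upwards [compl_mem_ae_iff.2 (measure_singleton (0 : V))] with x hx
    have hx0 : ‖x‖ ≠ 0 := norm_ne_zero_iff.2 hx
    have h1 : Tendsto (fun n : ℕ => ‖x‖ ^ 2 + 1 / ((n : ℝ) + 1)) atTop (𝓝 (‖x‖ ^ 2 + 0)) :=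
      tendsto_const_nhds.add tendsto_one_div_add_atTop_nhds_zero_nat
    have h2 := h1.sqrt
    rw [add_zero, Real.sqrt_sq (norm_nonneg x)] at h2
    exact tendsto_const_nhds.div h2 hx0
  refine (Lp.eLpNorm_lim_le_liminf_eLpNorm (fun n => (hmem n).1) _ hlim).trans ?_
  refine liminf_le_of_frequently_le' (Frequently.of_forall fun n => ?_)
  rw [(hmem n).eLpNorm_two_eq_ofReal_sqrt, (hφ.memLp_fderiv 2).eLpNorm_two_eq_ofReal_sqrt]
  have e2 : (2 : ℝ≥0∞) = ENNReal.ofReal 2 := by simp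
  rw [e2, ← ENNReal.ofReal_mul (by norm_num)]
  apply ENNReal.ofReal_le_ofReal
  rw [show (2 : ℝ) = √4 by rw [show (4 : ℝ) = 2 ^ 2 by norm_num]; simp,
    ← Real.sqrt_mul (by norm_num)]
  apply Real.sqrt_le_sqrt
  refine le_trans (le_of_eq ?_) (hφ.integral_sq_div_norm_sq_add_le hV (ε := 1 / ((n : ℝ) + 1))
    (by positivity))
  congr 1; funext x
  rw [Real.norm_eq_abs, sq_abs, div_pow, Real.sq_sqrt (hs n x).le]

theorem IsTestFunction.memLp_div_norm [(volume : Measure V).IsAddHaarMeasure]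
    (hV : 3 ≤ Module.finrank ℝ V) (hφ : IsTestFunction φ) :
    MemLp (fun x => φ x / ‖x‖) 2 volume :=
  ⟨(hφ.continuous.measurable.div measurable_norm).aestronglyMeasurable,
    (hφ.eLpNorm_div_norm_le hV).trans_lt
      (ENNReal.mul_lt_top (by simp) (hφ.memLp_fderiv 2).eLpNorm_lt_top)⟩

theorem IsTestFunction.integral_sq_div_norm_sq_le [(volume : Measure V).IsAddHaarMeasure]
    (hV : 3 ≤ Module.finrank ℝ V) (hφ : IsTestFunction φ) :
    ∫ x, (φ x / ‖x‖) ^ 2 ≤ 4 * testEnergy φ := by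
  have h := hφ.eLpNorm_div_norm_le hV
  rw [(hφ.memLp_div_norm hV).eLpNorm_two_eq_ofReal_sqrt,
    (hφ.memLp_fderiv 2).eLpNorm_two_eq_ofReal_sqrt] at h
  have e2 : (2 : ℝ≥0∞) = ENNReal.ofReal 2 := by simp
  rw [e2, ← ENNReal.ofReal_mul (by norm_num), ENNReal.ofReal_le_ofReal_iff (by positivity)] at h
  have hE : 0 ≤ ∫ x, ‖fderiv ℝ φ x‖ ^ 2 := testEnergy_nonneg φ
  rw [show (2 : ℝ) = √4 by rw [show (4 : ℝ) = 2 ^ 2 by norm_num]; simp,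
    ← Real.sqrt_mul (by norm_num), Real.sqrt_le_sqrt_iff (by positivity)] at h
  simpa [testEnergy, div_pow] using h

end Hardy

/-! ### A finite-dimensional substitute for Rellich's theorem -/

theorem sq_integral_le_measureReal_mul {α : Type*} [MeasurableSpace α] {μ : Measure α}
    [IsFiniteMeasure μ] {f : α → ℝ} (hf : MemLp f 2 μ) :
    (∫ x, f x ∂μ) ^ 2 ≤ μ.real Set.univ * ∫ x, f x ^ 2 ∂μ := by
  have hf1 : Integrable f μ := hf.integrable (by norm_num)
  set a := μ.real Set.univ with ha
  set b := ∫ x, f x ∂μ with hb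
  rcases (measureReal_nonneg : 0 ≤ a).eq_or_lt with h0 | h0
  · have : μ = 0 := by
      rw [← Measure.measure_univ_eq_zero]
      exact (measureReal_eq_zero_iff).1 h0.symm
    rw [hb, this]
    simp
  · have h : 0 ≤ ∫ x, (a * f x - b) ^ 2 ∂μ := integral_nonneg fun _ => sq_nonneg _
    have e : ∫ x, (a * f x - b) ^ 2 ∂μ = a * (a * ∫ x, f x ^ 2 ∂μ - b ^ 2) := by
      have : ∀ x, (a * f x - b) ^ 2 = a ^ 2 * f x ^ 2 - 2 * a * b * f x + b ^ 2 := fun x => by ring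
      simp_rw [this]
      have i1 : Integrable (fun x => a ^ 2 * f x ^ 2) μ := hf.integrable_sq.const_mul _
      have i2 : Integrable (fun x => 2 * a * b * f x) μ := hf1.const_mul _
      have i3 : Integrable (fun x => a ^ 2 * f x ^ 2 - 2 * a * b * f x) μ := i1.sub i2
      rw [integral_add i3 (integrable_const _), integral_sub i1 i2,
        integral_const_mul, integral_const_mul, integral_const, ← hb, ← ha, smul_eq_mul]
      ring
    rw [e] at h
    nlinarith [nonneg_of_mul_nonneg_right h h0]

section Compactness

variable {V : Type*} [NormedAddCommGroup V] [NormedSpace ℝ V] [FiniteDimensional ℝ V]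
  [MeasureSpace V] [BorelSpace V] [(volume : Measure V).IsAddHaarMeasure]

/-- Translations are Lipschitz in `L²`, with constant the `L²`-norm of the gradient. -/
theorem IsTestFunction.integral_sq_translate_sub_le {φ : V → ℝ} (hφ : IsTestFunction φ) (z : V) :
    ∫ x, (φ (x + z) - φ x) ^ 2 ≤ ‖z‖ ^ 2 * testEnergy φ := by
  have hD := hφ.continuous_fderiv
  have hDt : ∀ x, Continuous (fun t : ℝ => fderiv ℝ φ (x + t • z) z) := fun x =>
    (hD.comp (by fun_prop)).clm_apply continuous_const
  have hpt : ∀ x, (φ (x + z) - φ x) ^ 2 ≤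
      ∫ t in Set.Icc (0 : ℝ) 1, (‖z‖ * ‖fderiv ℝ φ (x + t • z)‖) ^ 2 := fun x => by
    have h1 : ∫ t in (0 : ℝ)..1, fderiv ℝ φ (x + t • z) z = φ (x + z) - φ x := by
      have := intervalIntegral.integral_eq_sub_of_hasDerivAt (a := (0 : ℝ)) (b := 1)
        (f := fun t : ℝ => φ (x + t • z)) (f' := fun t => fderiv ℝ φ (x + t • z) z) ?_
        ((hDt x).intervalIntegrable _ _)
      · simpa using this
      · intro t _
        have h2 : HasDerivAt (fun t : ℝ => x + t • z) z t := by
          simpa using ((hasDerivAt_id t).smul_const z).const_add x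
        exact (hφ.differentiable (x + t • z)).hasFDerivAt.comp_hasDerivAt t h2
    rw [← h1, intervalIntegral.integral_of_le zero_le_one, ← integral_Icc_eq_integral_Ioc]
    have hmem : MemLp (fun t : ℝ => fderiv ℝ φ (x + t • z) z) 2
        (volume.restrict (Set.Icc (0 : ℝ) 1)) := by
      rw [memLp_two_iff_integrable_sq (hDt x).aestronglyMeasurable]
      exact ((hDt x).pow 2).continuousOn.integrableOn_compact isCompact_Icc
    refine (sq_integral_le_measureReal_mul hmem).trans ?_
    simp only [measureReal_restrict_apply_univ, Real.volume_real_Icc, sub_zero, zero_le_one,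
      max_eq_left, one_mul]
    refine integral_mono (((hDt x).pow 2).continuousOn.integrableOn_compact isCompact_Icc) ?_
      fun t => ?_
    · refine Continuous.integrableOn_Icc (Continuous.pow (continuous_const.mul ?_) 2)
      exact (hD.comp (by fun_prop)).norm
    · change (fderiv ℝ φ (x + t • z) z) ^ 2 ≤ _
      rw [← sq_abs, mul_comm ‖z‖]
      gcongr
      exact (fderiv ℝ φ (x + t • z)).le_opNorm z
  set μ : Measure ℝ := volume.restrict (Set.Icc (0 : ℝ) 1)
  have hcont : Continuous (fun p : V × ℝ => (‖z‖ * ‖fderiv ℝ φ (p.1 + p.2 • z)‖) ^ 2) :=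
    (continuous_const.mul (hD.comp (by fun_prop)).norm).pow 2
  have hcontx : ∀ x : V, Integrable (fun t => (‖z‖ * ‖fderiv ℝ φ (x + t • z)‖) ^ 2) μ := fun x =>
    (Continuous.integrableOn_Icc ((continuous_const.mul (hD.comp (by fun_prop)).norm).pow 2))
  have key : ∫⁻ x, ENNReal.ofReal ((φ (x + z) - φ x) ^ 2) ≤
      ENNReal.ofReal (‖z‖ ^ 2 * testEnergy φ) := by
    calc ∫⁻ x, ENNReal.ofReal ((φ (x + z) - φ x) ^ 2)
        ≤ ∫⁻ x, ∫⁻ t, ENNReal.ofReal ((‖z‖ * ‖fderiv ℝ φ (x + t • z)‖) ^ 2) ∂μ := by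
          refine lintegral_mono fun x => ?_
          rw [← ofReal_integral_eq_lintegral_ofReal (hcontx x)
            (Eventually.of_forall fun _ => sq_nonneg _)]
          exact ENNReal.ofReal_le_ofReal (hpt x)
      _ = ∫⁻ t, (∫⁻ x, ENNReal.ofReal ((‖z‖ * ‖fderiv ℝ φ (x + t • z)‖) ^ 2)) ∂μ := by
          rw [lintegral_lintegral_swap]
          exact (ENNReal.continuous_ofReal.comp hcont).measurable.aemeasurable
      _ = ∫⁻ t, ENNReal.ofReal (‖z‖ ^ 2 * testEnergy φ) ∂μ := by
          refine lintegral_congr fun t => ?_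
          rw [lintegral_add_right_eq_self
            (fun x => ENNReal.ofReal ((‖z‖ * ‖fderiv ℝ φ x‖) ^ 2)) (t • z)]
          simp_rw [mul_pow]
          rw [← ofReal_integral_eq_lintegral_ofReal (hφ.integrable_fderiv_sq.const_mul _)
            (Eventually.of_forall fun _ => by positivity), integral_const_mul]
          rfl
      _ = ENNReal.ofReal (‖z‖ ^ 2 * testEnergy φ) := by simp [μ]
  have hc : Continuous (fun x => (φ (x + z) - φ x) ^ 2) :=
    ((hφ.continuous.comp (by fun_prop)).sub hφ.continuous).pow 2
  rw [integral_eq_lintegral_of_nonneg_ae (Eventually.of_forall fun _ => sq_nonneg _)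
    hc.aestronglyMeasurable]
  exact ENNReal.toReal_le_of_le_ofReal (mul_nonneg (sq_nonneg _) (testEnergy_nonneg φ)) key

omit [FiniteDimensional ℝ V] in
theorem IsTestFunction.memLp_translate {φ : V → ℝ} (hφ : IsTestFunction φ) (y : V) (p : ℝ≥0∞) :
    MemLp (fun x => φ (x + y)) p volume :=
  (hφ.memLp p).comp_measurePreserving (measurePreserving_add_right volume y)

/-- A value of `φ` is controlled by its oscillation at scale `h` and its integral over a ball of
radius `h` around any point `y` near `x`: compare `φ x` with `φ (x + z)`, then with `φ (z + y)`, and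
average over `z`. -/
theorem IsTestFunction.sq_le_translates {φ : V → ℝ} (hφ : IsTestFunction φ) {h δ : ℝ}
    {x y : V} (hxy : ‖x - y‖ ≤ δ) :
    φ x ^ 2 * volume.real (Metric.closedBall (0 : V) h) ^ 2 ≤
      3 * volume.real (Metric.closedBall (0 : V) h) *
        ((∫ z in Metric.closedBall (0 : V) h, (φ (x + z) - φ x) ^ 2) + δ ^ 2 * testEnergy φ) +
      3 * (∫ z in Metric.closedBall (0 : V) h, φ (z + y)) ^ 2 := by
  set B := Metric.closedBall (0 : V) h
  have : IsFiniteMeasure (volume.restrict B) :=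
    ⟨by simpa using (isCompact_closedBall (0 : V) h).measure_lt_top⟩
  have m1 : MemLp (fun z => φ (x + z) - φ x) 2 (volume.restrict B) := by
    refine MemLp.sub ?_ (memLp_const _)
    simpa [add_comm] using (hφ.memLp_translate x 2).restrict B
  have m2' : MemLp (fun z => φ (z + x) - φ (z + y)) 2 volume :=
    (hφ.memLp_translate x 2).sub (hφ.memLp_translate y 2)
  have m2 := m2'.restrict B
  have m3 := (hφ.memLp_translate y 2).restrict B
  have e : φ x * volume.real B = -(∫ z in B, (φ (x + z) - φ x)) +
      (∫ z in B, (φ (z + x) - φ (z + y))) + ∫ z in B, φ (z + y) := by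
    have i1 : Integrable (fun z => -(φ (x + z) - φ x)) (volume.restrict B) :=
      (m1.integrable (by norm_num)).neg
    have i2 : Integrable (fun z => φ (z + x) - φ (z + y)) (volume.restrict B) :=
      m2.integrable (by norm_num)
    have i3 : Integrable (fun z => -(φ (x + z) - φ x) + (φ (z + x) - φ (z + y)))
      (volume.restrict B) := i1.add i2
    rw [← integral_neg, ← integral_add i1 i2, ← integral_add i3 (m3.integrable (by norm_num))]
    have : ∀ z, -(φ (x + z) - φ x) + (φ (z + x) - φ (z + y)) + φ (z + y) = φ x := fun z => by
      rw [add_comm x z]; ring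
    simp_rw [this]
    simp [mul_comm]
  have c1 := sq_integral_le_measureReal_mul m1
  have c2 := sq_integral_le_measureReal_mul m2
  rw [measureReal_restrict_apply_univ] at c1 c2
  have c3 : ∫ z in B, (φ (z + x) - φ (z + y)) ^ 2 ≤ δ ^ 2 * testEnergy φ := by
    refine (setIntegral_le_integral m2'.integrable_sq
      (Eventually.of_forall fun _ => sq_nonneg _)).trans ?_
    have := integral_add_right_eq_self (μ := volume)
      (fun z => (φ (z + (x - y)) - φ z) ^ 2) y
    simp only [add_assoc, add_sub_cancel] at this
    rw [this]
    refine (hφ.integral_sq_translate_sub_le (x - y)).trans ?_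
    have := testEnergy_nonneg φ
    gcongr
  have hB : 0 ≤ volume.real B := measureReal_nonneg
  have c4 := mul_le_mul_of_nonneg_left c3 hB
  rw [← mul_pow, e]
  set a := ∫ z in B, (φ (x + z) - φ x)
  set b := ∫ z in B, (φ (z + x) - φ (z + y))
  set c := ∫ z in B, φ (z + y)
  nlinarith [sq_nonneg (a + b), sq_nonneg (a + c), sq_nonneg (b - c)]

/-- On a ball, the `L²`-norm of a test function is controlled by an arbitrarily small multiple of
the Dirichlet energy and finitely many of its averages. This is the form in which local
compactness of the embedding `D^{1,2} → L²` is used. -/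
theorem exists_finset_integral_sq_le (R : ℝ) {η : ℝ} (hη : 0 < η) :
    ∃ (s : Finset V) (h C : ℝ), 0 ≤ C ∧ ∀ φ : V → ℝ, IsTestFunction φ →
      ∫ x in Metric.closedBall (0 : V) R, φ x ^ 2 ≤ η * testEnergy φ +
        C * ∑ y ∈ s, (∫ z in Metric.closedBall (0 : V) h, φ (z + y)) ^ 2 := by
  -- The scale `h` of the averages comes first, then a `δ`-net of the ball, with `δ` small compared
  -- to the volume of balls of radius `h`.
  set h := min 1 (η / 6)
  have hh : 0 < h := by positivity
  have hh2 : 3 * h ^ 2 ≤ η / 2 := by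
    have h1 : h ≤ 1 := min_le_left _ _
    have h2 : h ≤ η / 6 := min_le_right _ _
    nlinarith
  set A := Metric.closedBall (0 : V) R
  set B := Metric.closedBall (0 : V) h
  have hA : IsCompact A := isCompact_closedBall _ _
  have hB : IsCompact B := isCompact_closedBall _ _
  set a := volume.real A
  set b := volume.real B
  have ha : 0 ≤ a := measureReal_nonneg
  have hb : 0 < b := ENNReal.toReal_pos (Metric.measure_closedBall_pos _ _ hh).ne'
    hB.measure_lt_top.ne
  set δ := min 1 (η * b / (6 * (a + 1)))
  have hδ : 0 < δ := by positivity
  have hδ2 : 3 * a * δ ^ 2 / b ≤ η / 2 := by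
    have h1 : δ ≤ 1 := min_le_left _ _
    have h2 : δ ≤ η * b / (6 * (a + 1)) := min_le_right _ _
    rw [le_div_iff₀ (by positivity)] at h2
    rw [div_le_iff₀ hb]
    nlinarith [mul_nonneg ha (mul_nonneg hδ.le (sub_nonneg.2 h1))]
  obtain ⟨s, -, hs⟩ := hA.elim_nhds_subcover (fun y => Metric.closedBall y δ)
    fun y _ => Metric.closedBall_mem_nhds y hδ
  refine ⟨s, h, 3 * a / b ^ 2, by positivity, fun φ hφ => ?_⟩
  have : IsFiniteMeasure (volume.restrict A) := ⟨by simpa using hA.measure_lt_top⟩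
  have : IsFiniteMeasure (volume.restrict B) := ⟨by simpa using hB.measure_lt_top⟩
  set E := testEnergy φ
  have hE : 0 ≤ E := testEnergy_nonneg φ
  set S := ∑ y ∈ s, (∫ z in B, φ (z + y)) ^ 2
  have hpt : ∀ x ∈ A, φ x ^ 2 ≤
      3 / b * (∫ z in B, (φ (x + z) - φ x) ^ 2) + (3 * δ ^ 2 * E / b + 3 * S / b ^ 2) := by
    intro x hx
    obtain ⟨y, hy, hxy⟩ := Set.mem_iUnion₂.1 (hs hx)
    have h1 := hφ.sq_le_translates (h := h) (by simpa [dist_eq_norm] using hxy)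
    have h2 : (∫ z in B, φ (z + y)) ^ 2 ≤ S :=
      Finset.single_le_sum (f := fun y => (∫ z in B, φ (z + y)) ^ 2)
        (fun _ _ => sq_nonneg _) hy
    have h3 : φ x ^ 2 * b ^ 2 ≤
        3 * b * ((∫ z in B, (φ (x + z) - φ x) ^ 2) + δ ^ 2 * E) + 3 * S := by
      linarith
    rw [← le_div_iff₀ (by positivity)] at h3
    refine h3.trans (le_of_eq ?_)
    field_simp
    ring
  have hcont : Continuous (fun p : V × V => (φ (p.1 + p.2) - φ p.1) ^ 2) :=
    ((hφ.continuous.comp (by fun_prop)).sub (hφ.continuous.comp (by fun_prop))).pow 2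
  have hprod : Integrable (fun p : V × V => (φ (p.1 + p.2) - φ p.1) ^ 2)
      ((volume.restrict A).prod (volume.restrict B)) := by
    rw [Measure.prod_restrict]
    exact hcont.continuousOn.integrableOn_compact (hA.prod hB)
  have hswap : ∫ x in A, ∫ z in B, (φ (x + z) - φ x) ^ 2 ≤ b * (h ^ 2 * E) := by
    rw [integral_integral_swap hprod]
    calc ∫ z in B, ∫ x in A, (φ (x + z) - φ x) ^ 2 ≤ ∫ z in B, h ^ 2 * E := by
          refine setIntegral_mono_on hprod.integral_prod_right (integrable_const _)
            Metric.isClosed_closedBall.measurableSet fun z hz => ?_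
          refine (setIntegral_le_integral ((hφ.memLp_translate z 2).sub
            (hφ.memLp 2)).integrable_sq (Eventually.of_forall fun _ => sq_nonneg _)).trans ?_
          refine (hφ.integral_sq_translate_sub_le z).trans ?_
          have : ‖z‖ ≤ h := by simpa [B] using hz
          gcongr
      _ = b * (h ^ 2 * E) := by simp [b]
  have hint : Integrable (fun x => 3 / b * ∫ z in B, (φ (x + z) - φ x) ^ 2)
      (volume.restrict A) := hprod.integral_prod_left.const_mul _
  have hint2 : Integrable (fun x => 3 / b * (∫ z in B, (φ (x + z) - φ x) ^ 2) +
      (3 * δ ^ 2 * E / b + 3 * S / b ^ 2)) (volume.restrict A) := hint.add (integrable_const _)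
  calc ∫ x in A, φ x ^ 2
      ≤ ∫ x in A, (3 / b * (∫ z in B, (φ (x + z) - φ x) ^ 2) +
          (3 * δ ^ 2 * E / b + 3 * S / b ^ 2)) :=
        setIntegral_mono_on ((hφ.memLp 2).integrable_sq.integrableOn)
          hint2
          Metric.isClosed_closedBall.measurableSet hpt
    _ = 3 / b * (∫ x in A, ∫ z in B, (φ (x + z) - φ x) ^ 2) +
          a * (3 * δ ^ 2 * E / b + 3 * S / b ^ 2) := by
        rw [integral_add hint (integrable_const _),
          integral_const_mul]
        simp [a]
    _ ≤ 3 / b * (b * (h ^ 2 * E)) + a * (3 * δ ^ 2 * E / b + 3 * S / b ^ 2) := by gcongr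
    _ = (3 * h ^ 2 + 3 * a * δ ^ 2 / b) * E + 3 * a / b ^ 2 * S := by field_simp; ring
    _ ≤ (η / 2 + η / 2) * E + 3 * a / b ^ 2 * S := by gcongr
    _ = η * E + 3 * a / b ^ 2 * S := by ring

end Compactness

/-! ### The Hardy form and its localization at the origin and at infinity -/

/-- The form `∫ (m / |x|²) φ²`, for functions given pointwise. -/
noncomputable def testForm {V : Type*} [NormedAddCommGroup V] [MeasureSpace V]
    (m φ : V → ℝ) : ℝ :=
  ∫ x, m x / ‖x‖ ^ 2 * φ x ^ 2

theorem MeasureTheory.MemLp.exists_ae_abs_le {α : Type*} [MeasurableSpace α] {μ : Measure α}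
    {m : α → ℝ} (hm : MemLp m ∞ μ) : ∃ M : ℝ, 0 ≤ M ∧ ∀ᵐ x ∂μ, |m x| ≤ M := by
  refine ⟨(eLpNormEssSup m μ).toReal, ENNReal.toReal_nonneg, ?_⟩
  have h := hm.eLpNorm_lt_top
  rw [eLpNorm_exponent_top] at h
  filter_upwards [ae_le_eLpNormEssSup (f := m) (μ := μ)] with x hx
  have := ENNReal.toReal_mono h.ne hx
  simpa using this

theorem testForm_eq {V : Type*} [NormedAddCommGroup V] [MeasureSpace V]
    (m φ : V → ℝ) : testForm m φ = ∫ x, m x * (φ x / ‖x‖) ^ 2 := by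
  unfold testForm
  congr 1; funext x; ring

/-- Leibniz' rule and Young's inequality. The derivative of `φ` enters with a factor close to `1`. -/
theorem norm_fderiv_mul_sq_le {V : Type*} [NormedAddCommGroup V] [NormedSpace ℝ V]
    {φ η : V → ℝ} {x : V} (hη : DifferentiableAt ℝ η x)
    (hφ : DifferentiableAt ℝ φ x) {δ : ℝ} (hδ : 0 < δ) :
    ‖fderiv ℝ (fun y => η y * φ y) x‖ ^ 2 ≤
      (1 + δ) * (η x ^ 2 * ‖fderiv ℝ φ x‖ ^ 2) +
        (1 + 1 / δ) * (‖fderiv ℝ η x‖ ^ 2 * φ x ^ 2) := by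
  rw [fderiv_fun_mul hη hφ]
  have h1 : ‖η x • fderiv ℝ φ x + φ x • fderiv ℝ η x‖ ≤
      |η x| * ‖fderiv ℝ φ x‖ + ‖fderiv ℝ η x‖ * |φ x| := by
    refine (norm_add_le _ _).trans (le_of_eq ?_)
    rw [norm_smul, norm_smul, Real.norm_eq_abs, Real.norm_eq_abs]
    ring
  have h2 := pow_le_pow_left₀ (norm_nonneg _) h1 2
  refine h2.trans ?_
  have e1 : η x ^ 2 * ‖fderiv ℝ φ x‖ ^ 2 = (|η x| * ‖fderiv ℝ φ x‖) ^ 2 := by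
    rw [mul_pow, sq_abs]
  have e2 : ‖fderiv ℝ η x‖ ^ 2 * φ x ^ 2 = (‖fderiv ℝ η x‖ * |φ x|) ^ 2 := by
    rw [mul_pow, sq_abs]
  rw [e1, e2]
  set a := |η x| * ‖fderiv ℝ φ x‖
  set b := ‖fderiv ℝ η x‖ * |φ x|
  have : (1 + δ) * a ^ 2 + (1 + 1 / δ) * b ^ 2 - (a + b) ^ 2 = (δ * a - b) ^ 2 / δ := by
    field_simp
    ring
  have h3 : 0 ≤ (δ * a - b) ^ 2 / δ := by positivity
  linarith

/-- Smooth cutoffs, `η₀` near the origin and `η₁` near infinity, whose supports do not overlap and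
whose derivatives are bounded and vanish outside a ball. -/
theorem exists_cutoffs {V : Type*} [NormedAddCommGroup V] [InnerProductSpace ℝ V]
    [FiniteDimensional ℝ V] {r R : ℝ} (hr : 0 < r) (hrR : r ≤ R) :
    ∃ (η₀ η₁ : V → ℝ) (L : ℝ), ContDiff ℝ ∞ η₀ ∧ ContDiff ℝ ∞ η₁ ∧
      (∀ x, 0 ≤ η₀ x ∧ η₀ x ≤ 1) ∧ (∀ x, 0 ≤ η₁ x ∧ η₁ x ≤ 1) ∧
      (∀ x, ‖x‖ ≤ r / 2 → η₀ x = 1) ∧ (∀ x, r ≤ ‖x‖ → η₀ x = 0) ∧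
      (∀ x, ‖x‖ ≤ R → η₁ x = 0) ∧ (∀ x, 2 * R ≤ ‖x‖ → η₁ x = 1) ∧
      (∀ x, ‖fderiv ℝ η₀ x‖ ≤ L) ∧ (∀ x, ‖fderiv ℝ η₁ x‖ ≤ L) ∧
      (∀ x, x ∉ Metric.closedBall (0 : V) (2 * R) → fderiv ℝ η₀ x = 0 ∧ fderiv ℝ η₁ x = 0) := by
  have hR : 0 < R := hr.trans_le hrR
  let β₀ : ContDiffBump (0 : V) := ⟨r / 2, r, by positivity, by linarith⟩
  let β₁ : ContDiffBump (0 : V) := ⟨R, 2 * R, hR, by linarith⟩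
  have hβ : ∀ β : ContDiffBump (0 : V), ∃ L, ∀ x, ‖fderiv ℝ β x‖ ≤ L := fun β =>
    (β.contDiff.continuous_fderiv (n := ∞) (by simp)).bounded_above_of_compact_support
      (β.hasCompactSupport.fderiv (𝕜 := ℝ))
  obtain ⟨L₀, hL₀⟩ := hβ β₀
  obtain ⟨L₁, hL₁⟩ := hβ β₁
  have hd1 : ∀ x, fderiv ℝ (fun x => 1 - β₁ x) x = -fderiv ℝ β₁ x := fun x => by
    rw [fderiv_const_sub]
  have hout : ∀ β : ContDiffBump (0 : V), ∀ x, β.rOut < ‖x‖ → fderiv ℝ β x = 0 := by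
    intro β x hx
    by_contra h
    have h1 := support_fderiv_subset ℝ (f := β) (Function.mem_support.2 h)
    rw [β.tsupport_eq, Metric.mem_closedBall, dist_zero_right] at h1
    linarith
  refine ⟨β₀, fun x => 1 - β₁ x, max L₀ L₁, β₀.contDiff, contDiff_const.sub β₁.contDiff,
    fun x => ⟨β₀.nonneg, β₀.le_one⟩, fun x => ⟨by linarith [β₁.le_one (x := x)],
      by linarith [β₁.nonneg (x := x)]⟩, fun x hx => β₀.one_of_mem_closedBall (by simpa using hx),
    fun x hx => β₀.zero_of_le_dist (by simpa using hx), fun x hx => ?_, fun x hx => ?_,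
    fun x => (hL₀ x).trans (le_max_left _ _), fun x => ?_, fun x hx => ?_⟩
  · change 1 - β₁ x = 0
    rw [β₁.one_of_mem_closedBall (by simpa using hx), sub_self]
  · change 1 - β₁ x = 1
    rw [β₁.zero_of_le_dist (by simpa using hx), sub_zero]
  · rw [hd1, norm_neg]
    exact (hL₁ x).trans (le_max_right _ _)
  · rw [Metric.mem_closedBall, dist_zero_right, not_le] at hx
    refine ⟨hout β₀ x ?_, ?_⟩
    · change r < ‖x‖
      linarith
    · rw [hd1, hout β₁ x hx, neg_zero]

section Localization

variable {V : Type*} [NormedAddCommGroup V] [InnerProductSpace ℝ V] [FiniteDimensional ℝ V]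
  [MeasureSpace V] [BorelSpace V] [(volume : Measure V).IsAddHaarMeasure]

theorem IsTestFunction.integrable_testForm (hV : 3 ≤ Module.finrank ℝ V) {φ : V → ℝ}
    (hφ : IsTestFunction φ) {m : V → ℝ} (hm : MemLp m ∞ volume) :
    Integrable (fun x => m x * (φ x / ‖x‖) ^ 2) :=
  (hφ.memLp_div_norm hV).integrable_sq.mul_of_top_right hm

/-- If the Hardy forms with weights `m₀` and `m₁` are dominated by the Dirichlet energy, then so is,
up to an arbitrarily small error and a term of lower order on a ball, the Hardy form of every weight
that is asymptotic to `m₀` at the origin and to `m₁` at infinity. -/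
theorem exists_mul_testForm_le (hV : 3 ≤ Module.finrank ℝ V) {m m₀ m₁ : V → ℝ}
    (hm : MemLp m ∞ volume) (hm₀ : MemLp m₀ ∞ volume) (hm₁ : MemLp m₁ ∞ volume)
    (h₀ : ∀ ε : ℝ, 0 < ε → ∃ r : ℝ, 0 < r ∧ ∀ᵐ x, ‖x‖ ≤ r → |m x - m₀ x| ≤ ε)
    (h₁ : ∀ ε : ℝ, 0 < ε → ∃ R : ℝ, 0 < R ∧ ∀ᵐ x, R ≤ ‖x‖ → |m x - m₁ x| ≤ ε)
    {t : ℝ} (ht : 0 ≤ t)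
    (ht₀ : ∀ φ : V → ℝ, IsTestFunction φ → t * testForm m₀ φ ≤ testEnergy φ)
    (ht₁ : ∀ φ : V → ℝ, IsTestFunction φ → t * testForm m₁ φ ≤ testEnergy φ)
    {δ : ℝ} (hδ : 0 < δ) :
    ∃ R C : ℝ, 0 ≤ C ∧ ∀ φ : V → ℝ, IsTestFunction φ →
      t * testForm m φ ≤ (1 + δ) * testEnergy φ +
        C * ∫ x in Metric.closedBall (0 : V) R, φ x ^ 2 := by
  set ε := δ / (8 * (t + 1))
  have hε : 0 < ε := by positivity
  have htε : t * ε * 4 ≤ δ / 2 := by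
    have : ε * (8 * (t + 1)) = δ := by simp only [ε]; field_simp
    nlinarith
  obtain ⟨r', hr', hr⟩ := h₀ ε hε
  obtain ⟨R, hR0, hR⟩ := h₁ ε hε
  set r := min r' R
  have hr0 : 0 < r := lt_min hr' hR0
  have hrR : r ≤ R := min_le_right _ _
  obtain ⟨η₀, η₁, L, hη₀, hη₁, hb₀, hb₁, hone₀, hzero₀, hzero₁, hone₁, hL₀, hL₁, hout⟩ :=
    exists_cutoffs (V := V) hr0 hrR
  obtain ⟨M, hM, hmM⟩ := hm.exists_ae_abs_le
  obtain ⟨M₀, hM₀, hmM₀⟩ := hm₀.exists_ae_abs_le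
  obtain ⟨M₁, hM₁, hmM₁⟩ := hm₁.exists_ae_abs_le
  set A := Metric.closedBall (0 : V) (2 * R)
  have hA : MeasurableSet A := Metric.isClosed_closedBall.measurableSet
  set C₁ := (M + M₀ + M₁) / (r / 2) ^ 2
  set C₂ := (1 + 1 / (δ / 2)) * (2 * L ^ 2)
  refine ⟨2 * R, C₂ + t * C₁, by positivity, fun φ hφ => ?_⟩
  have hφ₀ := hφ.mul_left hη₀
  have hφ₁ := hφ.mul_left hη₁
  have hIA : Integrable (A.indicator fun x => φ x ^ 2) := (hφ.memLp 2).integrable_sq.indicator hA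
  have hAint : ∫ x, A.indicator (fun x => φ x ^ 2) x = ∫ x in A, φ x ^ 2 := integral_indicator hA
  have hform : testForm m φ ≤ testForm m₀ (fun x => η₀ x * φ x) +
      testForm m₁ (fun x => η₁ x * φ x) + ε * (4 * testEnergy φ) +
      C₁ * ∫ x in A, φ x ^ 2 := by
    have i0 := hφ₀.integrable_testForm hV hm₀
    have i1 := hφ₁.integrable_testForm hV hm₁
    have i2 : Integrable (fun x => ε * (φ x / ‖x‖) ^ 2) :=
      (hφ.memLp_div_norm hV).integrable_sq.const_mul _
    have i3 : Integrable (fun x => C₁ * A.indicator (fun x => φ x ^ 2) x) := hIA.const_mul _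
    have i01 : Integrable (fun x => m₀ x * (η₀ x * φ x / ‖x‖) ^ 2 +
      m₁ x * (η₁ x * φ x / ‖x‖) ^ 2) := i0.add i1
    have i012 : Integrable (fun x => m₀ x * (η₀ x * φ x / ‖x‖) ^ 2 +
      m₁ x * (η₁ x * φ x / ‖x‖) ^ 2 + ε * (φ x / ‖x‖) ^ 2) := i01.add i2
    have i0123 : Integrable (fun x => m₀ x * (η₀ x * φ x / ‖x‖) ^ 2 +
      m₁ x * (η₁ x * φ x / ‖x‖) ^ 2 + ε * (φ x / ‖x‖) ^ 2 +
      C₁ * A.indicator (fun x => φ x ^ 2) x) := i012.add i3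
    have hmono := integral_mono_ae (hφ.integrable_testForm hV hm) i0123 ?_
    · rw [integral_add i012 i3, integral_add i01 i2, integral_add i0 i1, integral_const_mul,
        integral_const_mul, hAint] at hmono
      rw [testForm_eq, testForm_eq, testForm_eq]
      have := mul_le_mul_of_nonneg_left (hφ.integral_sq_div_norm_sq_le hV) hε.le
      linarith
    · filter_upwards [hr, hR, hmM, hmM₀, hmM₁] with x hxr hxR hxM hxM₀ hxM₁
      have hq : 0 ≤ (φ x / ‖x‖) ^ 2 := sq_nonneg _
      have hC₁ : 0 ≤ C₁ := by positivity
      have hind : 0 ≤ A.indicator (fun x => φ x ^ 2) x :=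
        Set.indicator_nonneg (fun _ _ => sq_nonneg _) x
      have e : m₀ x * (η₀ x * φ x / ‖x‖) ^ 2 + m₁ x * (η₁ x * φ x / ‖x‖) ^ 2 +
          ε * (φ x / ‖x‖) ^ 2 = (m₀ x * η₀ x ^ 2 + m₁ x * η₁ x ^ 2 + ε) * (φ x / ‖x‖) ^ 2 := by
        ring
      rw [e]
      -- Near the origin compare with `m₀`, near infinity with `m₁`; between, every weight is bounded.
      rcases le_or_gt ‖x‖ (r / 2) with hx | hx
      · have hx1 : ‖x‖ ≤ r' := by linarith [min_le_left r' R]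
        have h := (abs_le.1 (hxr hx1)).2
        rw [hone₀ x hx, hzero₁ x (by linarith)]
        have : m x ≤ m₀ x * 1 ^ 2 + m₁ x * 0 ^ 2 + ε := by linarith
        have := mul_le_mul_of_nonneg_right this hq
        nlinarith
      rcases le_or_gt (2 * R) ‖x‖ with hx2 | hx2
      · have h := (abs_le.1 (hxR (by linarith))).2
        rw [hone₁ x hx2, hzero₀ x (by linarith)]
        have : m x ≤ m₀ x * 0 ^ 2 + m₁ x * 1 ^ 2 + ε := by linarith
        have := mul_le_mul_of_nonneg_right this hq
        nlinarith
      · have hxA : x ∈ A := by simpa [A] using hx2.le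
        rw [Set.indicator_of_mem hxA]
        have s0 : η₀ x ^ 2 ≤ 1 := pow_le_one₀ (hb₀ x).1 (hb₀ x).2
        have s1 : η₁ x ^ 2 ≤ 1 := pow_le_one₀ (hb₁ x).1 (hb₁ x).2
        have b0 : -(m₀ x * η₀ x ^ 2) ≤ M₀ := by
          nlinarith [(abs_le.1 hxM₀).1, sq_nonneg (η₀ x)]
        have b1 : -(m₁ x * η₁ x ^ 2) ≤ M₁ := by
          nlinarith [(abs_le.1 hxM₁).1, sq_nonneg (η₁ x)]
        have b : m x ≤ (m₀ x * η₀ x ^ 2 + m₁ x * η₁ x ^ 2 + ε) + (M + M₀ + M₁) := by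
          linarith [(abs_le.1 hxM).2]
        have c := mul_le_mul_of_nonneg_right b hq
        have d : (φ x / ‖x‖) ^ 2 ≤ φ x ^ 2 / (r / 2) ^ 2 := by
          rw [div_pow]
          gcongr
        have d' := mul_le_mul_of_nonneg_left d (by positivity : 0 ≤ M + M₀ + M₁)
        have e' : C₁ * φ x ^ 2 = (M + M₀ + M₁) * (φ x ^ 2 / (r / 2) ^ 2) := by
          simp only [C₁]; ring
        rw [e']
        linarith
  have henergy : testEnergy (fun x => η₀ x * φ x) + testEnergy (fun x => η₁ x * φ x) ≤
      (1 + δ / 2) * testEnergy φ + C₂ * ∫ x in A, φ x ^ 2 := by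
    unfold testEnergy
    have i1 : Integrable (fun x => (1 + δ / 2) * ‖fderiv ℝ φ x‖ ^ 2) :=
      hφ.integrable_fderiv_sq.const_mul _
    have i2 : Integrable (fun x => C₂ * A.indicator (fun x => φ x ^ 2) x) := hIA.const_mul _
    rw [← integral_add hφ₀.integrable_fderiv_sq hφ₁.integrable_fderiv_sq, ← hAint,
      ← integral_const_mul, ← integral_const_mul, ← integral_add i1 i2]
    refine integral_mono (hφ₀.integrable_fderiv_sq.add hφ₁.integrable_fderiv_sq) (i1.add i2)
      fun x => ?_
    have k0 := norm_fderiv_mul_sq_le (hη₀.differentiable (by simp) x) (hφ.differentiable x)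
      (half_pos hδ)
    have k1 := norm_fderiv_mul_sq_le (hη₁.differentiable (by simp) x) (hφ.differentiable x)
      (half_pos hδ)
    -- The supports of the cutoffs do not overlap.
    have hsum : η₀ x ^ 2 + η₁ x ^ 2 ≤ 1 := by
      rcases le_total ‖x‖ R with hx | hx
      · rw [hzero₁ x hx]
        simpa using pow_le_one₀ (n := 2) (hb₀ x).1 (hb₀ x).2
      · rw [hzero₀ x (hrR.trans hx)]
        simpa using pow_le_one₀ (n := 2) (hb₁ x).1 (hb₁ x).2
    have hmain : (1 + δ / 2) * (η₀ x ^ 2 * ‖fderiv ℝ φ x‖ ^ 2) +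
        (1 + δ / 2) * (η₁ x ^ 2 * ‖fderiv ℝ φ x‖ ^ 2) ≤ (1 + δ / 2) * ‖fderiv ℝ φ x‖ ^ 2 := by
      have := mul_le_mul_of_nonneg_right hsum
        (by positivity : 0 ≤ (1 + δ / 2) * ‖fderiv ℝ φ x‖ ^ 2)
      linarith
    have hrest : (1 + 1 / (δ / 2)) * (‖fderiv ℝ η₀ x‖ ^ 2 * φ x ^ 2) +
        (1 + 1 / (δ / 2)) * (‖fderiv ℝ η₁ x‖ ^ 2 * φ x ^ 2) ≤
        C₂ * A.indicator (fun x => φ x ^ 2) x := by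
      by_cases hxA : x ∈ A
      · rw [Set.indicator_of_mem hxA]
        have l0 : ‖fderiv ℝ η₀ x‖ ^ 2 ≤ L ^ 2 := pow_le_pow_left₀ (norm_nonneg _) (hL₀ x) 2
        have l1 : ‖fderiv ℝ η₁ x‖ ^ 2 ≤ L ^ 2 := pow_le_pow_left₀ (norm_nonneg _) (hL₁ x) 2
        have : ‖fderiv ℝ η₀ x‖ ^ 2 + ‖fderiv ℝ η₁ x‖ ^ 2 ≤ 2 * L ^ 2 := by linarith
        have := mul_le_mul_of_nonneg_right this
          (by positivity : 0 ≤ (1 + 1 / (δ / 2)) * φ x ^ 2)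
        simp only [C₂]
        linarith
      · rw [(hout x hxA).1, (hout x hxA).2, Set.indicator_of_notMem hxA]
        simp
    change ‖fderiv ℝ (fun y => η₀ y * φ y) x‖ ^ 2 + ‖fderiv ℝ (fun y => η₁ y * φ y) x‖ ^ 2 ≤
      (1 + δ / 2) * ‖fderiv ℝ φ x‖ ^ 2 + C₂ * A.indicator (fun x => φ x ^ 2) x
    linarith
  have f0 := ht₀ _ hφ₀
  have f1 := ht₁ _ hφ₁
  have f2 := mul_le_mul_of_nonneg_left hform ht
  have f3 := mul_le_mul_of_nonneg_right htε (testEnergy_nonneg φ)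
  linarith

end Localization

/-! ### Weights with a limit along dilations -/

section Dilation

variable {V : Type*} [NormedAddCommGroup V] [NormedSpace ℝ V] [FiniteDimensional ℝ V]
  [MeasurableSpace V] [BorelSpace V] {μ : Measure V} [μ.IsAddHaarMeasure]

theorem quasiMeasurePreserving_const_smul {c : ℝ} (hc : c ≠ 0) :
    Measure.QuasiMeasurePreserving (fun x : V => c • x) μ μ :=
  ⟨measurable_const_smul c, by
    rw [Measure.map_addHaar_smul μ hc]
    exact Measure.smul_absolutelyContinuous⟩

theorem ae_of_ae_const_smul {c : ℝ} (hc : c ≠ 0) {P : V → Prop} (h : ∀ᵐ x ∂μ, P (c • x)) :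
    ∀ᵐ x ∂μ, P x := by
  filter_upwards [(quasiMeasurePreserving_const_smul (μ := μ) (inv_ne_zero hc)).ae h] with x hx
  simpa [smul_smul, hc] using hx

/-- A limit of `m` along the dilations by `c ^ j` is invariant under these dilations. -/
theorem ae_eq_of_tendsto_dilation {m M : V → ℝ} {c : ℝ} (hc : c ≠ 0)
    (h : ∀ᵐ x ∂μ, Tendsto (fun j : ℕ => m (c ^ j • x)) atTop (𝓝 (M x))) (j : ℕ) :
    ∀ᵐ x ∂μ, M (c ^ j • x) = M x := by
  filter_upwards [h, (quasiMeasurePreserving_const_smul (μ := μ) (pow_ne_zero j hc)).ae h]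
    with x hx hjx
  have : (fun i : ℕ => m (c ^ i • c ^ j • x)) = fun i : ℕ => m (c ^ (i + j) • x) := by
    funext i; rw [smul_smul, pow_add]
  rw [this] at hjx
  exact tendsto_nhds_unique hjx (hx.comp (tendsto_add_atTop_nat j))

theorem memLp_top_of_tendsto_dilation {m M : V → ℝ} {c : ℝ} (hc : c ≠ 0) (hm : MemLp m ∞ μ)
    (h : ∀ᵐ x ∂μ, Tendsto (fun j : ℕ => m (c ^ j • x)) atTop (𝓝 (M x))) : MemLp M ∞ μ := by
  obtain ⟨B, -, hB⟩ := hm.exists_ae_abs_le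
  have hq := fun j : ℕ => quasiMeasurePreserving_const_smul (μ := μ) (pow_ne_zero j hc)
  refine memLp_top_of_bound (aestronglyMeasurable_of_tendsto_ae atTop
    (fun j => hm.1.comp_quasiMeasurePreserving (hq j)) h) B ?_
  filter_upwards [h, ae_all_iff.2 fun j => (hq j).ae hB] with x hx hxB
  exact le_of_tendsto' hx.abs hxB

/-- By invariance, closeness of the dilates of `m` to their limit on a set is closeness of `m` itself
to the limit on a dilate of that set. -/
theorem ae_abs_sub_le_of_dilation {m M : V → ℝ} {c ε : ℝ} (hc : c ≠ 0)
    (h : ∀ᵐ x ∂μ, Tendsto (fun j : ℕ => m (c ^ j • x)) atTop (𝓝 (M x))) {j : ℕ} {P : V → Prop}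
    (hP : ∀ᵐ x ∂μ, P x → |m (c ^ j • x) - M x| ≤ ε) :
    ∀ᵐ x ∂μ, P ((c ^ j)⁻¹ • x) → |m x - M x| ≤ ε := by
  have hcj := pow_ne_zero j hc
  refine ae_of_ae_const_smul hcj ?_
  filter_upwards [hP, ae_eq_of_tendsto_dilation hc h j] with x hx hMx hPx
  rw [hMx]
  exact hx (by simpa [smul_smul, hcj] using hPx)

end Dilation

/-! ### Minimizing sequences are compact below the threshold at the origin and at infinity -/

theorem IsTestFunction.testEnergy_const_mul {V : Type*} [NormedAddCommGroup V]
    [NormedSpace ℝ V] [MeasureSpace V] {φ : V → ℝ} (hφ : IsTestFunction φ) (c : ℝ) :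
    testEnergy (fun x => c * φ x) = c ^ 2 * testEnergy φ := by
  unfold testEnergy
  rw [← integral_const_mul]
  congr 1; funext x
  rw [fderiv_const_mul (hφ.differentiable x), norm_smul, mul_pow, Real.norm_eq_abs, sq_abs]

theorem testForm_const_mul {V : Type*} [NormedAddCommGroup V] [MeasureSpace V]
    (m φ : V → ℝ) (c : ℝ) :
    testForm m (fun x => c * φ x) = c ^ 2 * testForm m φ := by
  unfold testForm
  rw [← integral_const_mul]
  congr 1; funext x
  ring

section Minimizing

variable {V : Type*} [NormedAddCommGroup V] [InnerProductSpace ℝ V] [FiniteDimensional ℝ V]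
  [MeasureSpace V] [BorelSpace V] [(volume : Measure V).IsAddHaarMeasure] {φ ψ m : V → ℝ}

theorem IsTestFunction.testEnergy_sub_add_add (hφ : IsTestFunction φ) (hψ : IsTestFunction ψ) :
    testEnergy (fun x => φ x - ψ x) + testEnergy (fun x => φ x + ψ x) =
      2 * (testEnergy φ + testEnergy ψ) := by
  unfold testEnergy
  rw [← integral_add (hφ.sub hψ).integrable_fderiv_sq (hφ.add hψ).integrable_fderiv_sq,
    ← integral_add hφ.integrable_fderiv_sq hψ.integrable_fderiv_sq, ← integral_const_mul]
  congr 1; funext x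
  rw [hφ.fderiv_sub hψ, fderiv_fun_add (hφ.differentiable x) (hψ.differentiable x)]
  have h := parallelogram_law_with_norm ℝ ((InnerProductSpace.toDual ℝ V).symm (fderiv ℝ φ x))
    ((InnerProductSpace.toDual ℝ V).symm (fderiv ℝ ψ x))
  rw [← map_add, ← map_sub] at h
  simp only [LinearIsometryEquiv.norm_map] at h
  linarith

theorem IsTestFunction.testForm_sub_add_add (hV : 3 ≤ Module.finrank ℝ V)
    (hφ : IsTestFunction φ) (hψ : IsTestFunction ψ) (hm : MemLp m ∞ volume) :
    testForm m (fun x => φ x - ψ x) + testForm m (fun x => φ x + ψ x) =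
      2 * (testForm m φ + testForm m ψ) := by
  simp only [testForm_eq]
  rw [← integral_add ((hφ.sub hψ).integrable_testForm hV hm)
    ((hφ.add hψ).integrable_testForm hV hm), ← integral_add (hφ.integrable_testForm hV hm)
    (hψ.integrable_testForm hV hm), ← integral_const_mul]
  congr 1; funext x
  ring

/-- Averages over balls are bounded functionals for the Dirichlet energy. -/
theorem IsTestFunction.sq_setIntegral_translate_le (hV : 3 ≤ Module.finrank ℝ V)
    (hφ : IsTestFunction φ) {h : ℝ} (y : V) :
    (∫ z in Metric.closedBall (0 : V) h, φ (z + y)) ^ 2 ≤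
      volume.real (Metric.closedBall (0 : V) h) * ((h + ‖y‖) ^ 2 * (4 * testEnergy φ)) := by
  set B := Metric.closedBall (0 : V) h
  have : IsFiniteMeasure (volume.restrict B) :=
    ⟨by simpa using (isCompact_closedBall (0 : V) h).measure_lt_top⟩
  have : Nontrivial V := Module.nontrivial_of_finrank_pos (R := ℝ) (by omega)
  have h1 := sq_integral_le_measureReal_mul ((hφ.memLp_translate y 2).restrict B)
  rw [measureReal_restrict_apply_univ] at h1
  refine h1.trans (mul_le_mul_of_nonneg_left ?_ measureReal_nonneg)
  have hi : Integrable (fun x => (h + ‖y‖) ^ 2 * (φ x / ‖x‖) ^ 2) :=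
    (hφ.memLp_div_norm hV).integrable_sq.const_mul _
  have hi' : Integrable (fun z => (h + ‖y‖) ^ 2 * (φ (z + y) / ‖z + y‖) ^ 2) :=
    hi.comp_add_right y
  have hne : ∀ᵐ z : V, z ≠ -y := compl_mem_ae_iff.2 (measure_singleton (-y))
  calc ∫ z in B, φ (z + y) ^ 2 ≤ ∫ z in B, (h + ‖y‖) ^ 2 * (φ (z + y) / ‖z + y‖) ^ 2 := by
        refine setIntegral_mono_on_ae (hφ.memLp_translate y 2).integrable_sq.integrableOn
          hi'.integrableOn Metric.isClosed_closedBall.measurableSet ?_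
        filter_upwards [hne] with z hz hzB
        have hz0 : 0 < ‖z + y‖ := norm_pos_iff.2 fun h0 => hz (eq_neg_of_add_eq_zero_left h0)
        have hz1 : ‖z + y‖ ≤ h + ‖y‖ := (norm_add_le _ _).trans (by
          have : ‖z‖ ≤ h := by simpa [B] using hzB
          linarith)
        calc φ (z + y) ^ 2 = ‖z + y‖ ^ 2 * (φ (z + y) / ‖z + y‖) ^ 2 := by field_simp
          _ ≤ _ := by gcongr
    _ ≤ ∫ z, (h + ‖y‖) ^ 2 * (φ (z + y) / ‖z + y‖) ^ 2 :=
        setIntegral_le_integral hi' (Eventually.of_forall fun _ => by positivity)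
    _ = (h + ‖y‖) ^ 2 * ∫ x, (φ x / ‖x‖) ^ 2 := by
        rw [integral_add_right_eq_self (fun x => (h + ‖y‖) ^ 2 * (φ x / ‖x‖) ^ 2) y,
          integral_const_mul]
    _ ≤ _ := mul_le_mul_of_nonneg_left (hφ.integral_sq_div_norm_sq_le hV) (sq_nonneg _)

/-- A normalized minimizing sequence has a subsequence that is Cauchy in the Dirichlet norm, if at a
level `t > Λ` the form is dominated by the energy up to lower order terms. -/
theorem exists_subseq_testEnergy_cauchy (hV : 3 ≤ Module.finrank ℝ V) (hm : MemLp m ∞ volume)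
    {lam t : ℝ} (hlam : 0 ≤ lam) (hlt : lam < t)
    (hle : ∀ φ : V → ℝ, IsTestFunction φ → lam * testForm m φ ≤ testEnergy φ)
    (hloc : ∀ δ : ℝ, 0 < δ → ∃ R C : ℝ, 0 ≤ C ∧ ∀ φ : V → ℝ, IsTestFunction φ →
      t * testForm m φ ≤ (1 + δ) * testEnergy φ +
        C * ∫ x in Metric.closedBall (0 : V) R, φ x ^ 2)
    {f : ℕ → V → ℝ} (hf : ∀ k, IsTestFunction (f k)) (hf1 : ∀ k, testForm m (f k) = 1)
    (hfE : Tendsto (fun k => testEnergy (f k)) atTop (𝓝 lam)) :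
    ∃ ns : ℕ → ℕ, StrictMono ns ∧
      Tendsto (fun n : ℕ × ℕ => testEnergy (fun x => f (ns n.1) x - f (ns n.2) x)) atTop
        (𝓝 0) := by
  have ht : 0 < t := hlam.trans_lt hlt
  set δ := (t - lam) / (4 * t)
  have hδ : 0 < δ := div_pos (by linarith) (by positivity)
  have hδ2 : lam * (1 + 2 * δ) ≤ (t + lam) / 2 := by
    have : δ * (4 * t) = t - lam := by simp only [δ]; field_simp
    nlinarith
  obtain ⟨R, C, hC, hRC⟩ := hloc δ hδ
  obtain ⟨s, h, C', hC', hs⟩ := exists_finset_integral_sq_le (V := V) R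
    (η := δ / (C + 1)) (by positivity)
  set S : (V → ℝ) → ℝ := fun φ => ∑ y ∈ s, (∫ z in Metric.closedBall (0 : V) h, φ (z + y)) ^ 2
  -- The deficit `E - ΛB` and finitely many averages control the energy.
  have hcoer : ∀ φ : V → ℝ, IsTestFunction φ → (t - lam) / 2 * testEnergy φ ≤
      t * (testEnergy φ - lam * testForm m φ) + lam * (C * C') * S φ := fun φ hφ => by
    have h1 := hRC φ hφ
    have h2 := mul_le_mul_of_nonneg_left (hs φ hφ) hC
    have hE := testEnergy_nonneg φ
    have h3 : C * (δ / (C + 1)) ≤ δ := by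
      rw [← mul_div_assoc, div_le_iff₀ (by positivity)]
      nlinarith
    have h4 : t * testForm m φ ≤ (1 + 2 * δ) * testEnergy φ + C * C' * S φ := by
      have := mul_le_mul_of_nonneg_right h3 hE
      simp only [S]
      linarith
    have h5 := mul_le_mul_of_nonneg_left h4 hlam
    have h6 := mul_le_mul_of_nonneg_right hδ2 hE
    linarith
  -- The averages along the sequence converge after passing to a subsequence.
  obtain ⟨K, hK⟩ := hfE.bddAbove_range
  let ℓ : ℕ → s → ℝ := fun k y => ∫ z in Metric.closedBall (0 : V) h, f k (z + (y : V))
  set D := ∑ y ∈ s, volume.real (Metric.closedBall (0 : V) h) * ((h + ‖y‖) ^ 2 * (4 * K))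
  have hbd : ∀ k, ℓ k ∈ Metric.closedBall (0 : s → ℝ) √D := fun k => by
    have hEK : testEnergy (f k) ≤ K := hK ⟨k, rfl⟩
    have hK0 : 0 ≤ K := (testEnergy_nonneg _).trans hEK
    rw [mem_closedBall_zero_iff, pi_norm_le_iff_of_nonneg (Real.sqrt_nonneg _)]
    intro y
    refine Real.le_sqrt_of_sq_le ?_
    rw [Real.norm_eq_abs, sq_abs]
    refine ((hf k).sq_setIntegral_translate_le hV (y : V)).trans ?_
    refine le_trans ?_ (Finset.single_le_sum (f := fun y : V =>
      volume.real (Metric.closedBall (0 : V) h) * ((h + ‖y‖) ^ 2 * (4 * K)))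
      (fun _ _ => by positivity) y.2)
    gcongr
  obtain ⟨a, -, ns, hns, hlim⟩ := tendsto_subseq_of_bounded Metric.isBounded_closedBall hbd
  refine ⟨ns, hns, ?_⟩
  have h1 : Tendsto (Prod.fst : ℕ × ℕ → ℕ) atTop atTop := by
    rw [← prod_atTop_atTop_eq]; exact tendsto_fst
  have h2 : Tendsto (Prod.snd : ℕ × ℕ → ℕ) atTop atTop := by
    rw [← prod_atTop_atTop_eq]; exact tendsto_snd
  have hS : Tendsto (fun n : ℕ × ℕ => S (fun x => f (ns n.1) x - f (ns n.2) x)) atTop (𝓝 0) := by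
    have hSeq : ∀ n : ℕ × ℕ, S (fun x => f (ns n.1) x - f (ns n.2) x) =
        ∑ y : s, (ℓ (ns n.1) y - ℓ (ns n.2) y) ^ 2 := fun n => by
      simp only [S]
      rw [← Finset.sum_coe_sort]
      refine Finset.sum_congr rfl fun y _ => ?_
      simp only [ℓ]
      rw [integral_sub]
      · exact (memLp_one_iff_integrable.1 ((hf _).memLp_translate (y : V) 1)).integrableOn
      · exact (memLp_one_iff_integrable.1 ((hf _).memLp_translate (y : V) 1)).integrableOn
    simp_rw [hSeq]
    have h0 : (0 : ℝ) = ∑ y : s, (a y - a y) ^ 2 := by simp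
    rw [h0]
    have hy := tendsto_pi_nhds.1 hlim
    exact tendsto_finsetSum _ fun y _ => (((hy y).comp h1).sub ((hy y).comp h2)).pow 2
  have hE0 : Tendsto (fun k => testEnergy (f (ns k)) - lam) atTop (𝓝 0) := by
    have := (hfE.comp hns.tendsto_atTop).sub_const lam
    rwa [sub_self] at this
  have hQ : Tendsto (fun n : ℕ × ℕ => 2 * ((testEnergy (f (ns n.1)) - lam) +
      (testEnergy (f (ns n.2)) - lam))) atTop (𝓝 0) := by
    simpa using ((hE0.comp h1).add (hE0.comp h2)).const_mul 2
  have hfin : Tendsto (fun n : ℕ × ℕ => 2 / (t - lam) * (t * (2 * ((testEnergy (f (ns n.1)) - lam) +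
      (testEnergy (f (ns n.2)) - lam))) + lam * (C * C') *
        S (fun x => f (ns n.1) x - f (ns n.2) x))) atTop (𝓝 0) := by
    simpa using ((hQ.const_mul t).add (hS.const_mul (lam * (C * C')))).const_mul (2 / (t - lam))
  refine squeeze_zero (fun _ => testEnergy_nonneg _) (fun n => ?_) hfin
  have hsub := (hf (ns n.1)).sub (hf (ns n.2))
  have hadd := (hf (ns n.1)).add (hf (ns n.2))
  have e1 := (hf (ns n.1)).testEnergy_sub_add_add (hf (ns n.2))
  have e2 := (hf (ns n.1)).testForm_sub_add_add hV (hf (ns n.2)) hm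
  rw [hf1, hf1] at e2
  have e3 := hle _ hadd
  have e4 := hcoer _ hsub
  -- By the parallelogram law, as the deficit of the sum is nonnegative.
  have e5 : testEnergy (fun x => f (ns n.1) x - f (ns n.2) x) -
      lam * testForm m (fun x => f (ns n.1) x - f (ns n.2) x) ≤
      2 * ((testEnergy (f (ns n.1)) - lam) + (testEnergy (f (ns n.2)) - lam)) := by
    nlinarith
  have e6 := mul_le_mul_of_nonneg_left e5 ht.le
  have hpos : 0 < t - lam := by linarith
  rw [div_mul_eq_mul_div, le_div_iff₀ hpos]
  linarith

end Minimizing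

/-! ### The space `D^{1,2}` and test functions -/

/-- Completeness of `L^p`, for sequences of functions. -/
theorem exists_memLp_tendsto_of_cauchy {α F : Type*} [MeasurableSpace α] {μ : Measure α}
    [NormedAddCommGroup F] [CompleteSpace F] {p : ℝ≥0∞} (hp : 1 ≤ p) {f : ℕ → α → F}
    (hf : ∀ k, MemLp (f k) p μ)
    (hc : Tendsto (fun n : ℕ × ℕ => eLpNorm (f n.1 - f n.2) p μ) atTop (𝓝 0)) :
    ∃ g : α → F, MemLp g p μ ∧ Tendsto (fun k => eLpNorm (f k - g) p μ) atTop (𝓝 0) := by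
  have : Fact (1 ≤ p) := ⟨hp⟩
  have hcs : CauchySeq (fun k => (hf k).toLp (f k)) := by
    rw [Lp.cauchySeq_Lp_iff_cauchySeq_eLpNorm]
    refine hc.congr fun n => eLpNorm_congr_ae ?_
    exact ((hf n.1).coeFn_toLp.sub (hf n.2).coeFn_toLp).symm
  obtain ⟨g, hg⟩ := cauchySeq_tendsto_of_complete hcs
  refine ⟨g, Lp.memLp g, ?_⟩
  rw [Lp.tendsto_Lp_iff_tendsto_eLpNorm'] at hg
  refine hg.congr fun k => eLpNorm_congr_ae ?_
  filter_upwards [(hf k).coeFn_toLp] with x hx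
  simp [hx]

section Gradient

variable {V : Type*} [NormedAddCommGroup V] [InnerProductSpace ℝ V] [FiniteDimensional ℝ V]
  {φ ψ : V → ℝ}

theorem norm_gradient (φ : V → ℝ) (x : V) : ‖gradient φ x‖ = ‖fderiv ℝ φ x‖ :=
  LinearIsometryEquiv.norm_map _ _

theorem IsTestFunction.gradient_sub (hφ : IsTestFunction φ) (hψ : IsTestFunction ψ) (x : V) :
    gradient (fun x => φ x - ψ x) x = gradient φ x - gradient ψ x := by
  simp only [gradient, hφ.fderiv_sub hψ, map_sub]

theorem IsTestFunction.memLp_gradient [MeasurableSpace V] [BorelSpace V] {μ : Measure V}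
    [IsFiniteMeasureOnCompacts μ] (hφ : IsTestFunction φ) (p : ℝ≥0∞) :
    MemLp (gradient φ) p μ :=
  (hφ.memLp_fderiv p).of_le
    (((InnerProductSpace.toDual ℝ V).symm.continuous.comp
      hφ.continuous_fderiv).aestronglyMeasurable)
    (Eventually.of_forall fun x => (norm_gradient φ x).le)

end Gradient

namespace D12

variable {N : ℕ}

theorem one_le_exponent (hN : 3 ≤ N) : 1 ≤ ENNReal.ofReal (2 * (N : ℝ) / ((N : ℝ) - 2)) := by
  have : (3 : ℝ) ≤ N := by exact_mod_cast hN
  rw [ENNReal.one_le_ofReal, le_div_iff₀ (by linarith)]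
  linarith

/-- A test function as an element of `D^{1,2}`. -/
noncomputable def ofTest {φ : EuclideanSpace ℝ (Fin N) → ℝ} (hφ : IsTestFunction φ) : D12 N where
  toFun := φ
  grad := gradient φ
  memLp_toFun := hφ.memLp _
  memLp_grad := hφ.memLp_gradient 2
  exists_approx := ⟨fun _ => φ, fun _ => ⟨hφ.contDiff, hφ.hasCompactSupport⟩, by simp, by simp⟩

theorem dirichletEnergy_ofTest {φ : EuclideanSpace ℝ (Fin N) → ℝ} (hφ : IsTestFunction φ) :
    dirichletEnergy (ofTest hφ) = testEnergy φ := by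
  simp only [dirichletEnergy, testEnergy, ofTest, norm_gradient]

theorem hardyForm_ofTest (m : EuclideanSpace ℝ (Fin N) → ℝ)
    {φ : EuclideanSpace ℝ (Fin N) → ℝ} (hφ : IsTestFunction φ) :
    hardyForm m (ofTest hφ) = testForm m φ := rfl

/-- The test functions `f k` converge to `u` in `D^{1,2}`. -/
structure Approx (f : ℕ → EuclideanSpace ℝ (Fin N) → ℝ) (u : D12 N) : Prop where
  isTestFunction : ∀ k, IsTestFunction (f k)
  tendsto_toFun : Tendsto (fun k => eLpNorm (fun x => f k x - u.toFun x)
      (ENNReal.ofReal (2 * (N : ℝ) / ((N : ℝ) - 2))) volume) atTop (𝓝 0)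
  tendsto_grad : Tendsto (fun k => eLpNorm (fun x => gradient (f k) x - u.grad x) 2 volume)
    atTop (𝓝 0)

theorem exists_approx' (u : D12 N) : ∃ f, Approx f u := by
  obtain ⟨f, h1, h2, h3⟩ := u.exists_approx
  exact ⟨f, fun k => ⟨(h1 k).1, (h1 k).2⟩, h2, h3⟩

variable {f : ℕ → EuclideanSpace ℝ (Fin N) → ℝ} {u : D12 N}

theorem Approx.tendsto_testEnergy (h : Approx f u) :
    Tendsto (fun k => testEnergy (f k)) atTop (𝓝 (dirichletEnergy u)) := by
  have h1 := tendsto_integral_mul_sq (memLp_top_const (1 : ℝ))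
    (fun k => ((h.isTestFunction k).memLp_gradient (μ := volume) 2).norm) u.memLp_grad.norm
    (tendsto_of_tendsto_of_tendsto_of_le_of_le tendsto_const_nhds h.tendsto_grad
      (fun _ => zero_le) fun k => eLpNorm_mono fun x => by
        simpa using abs_norm_sub_norm_le (gradient (f k) x) (u.grad x))
  simpa [testEnergy, dirichletEnergy, norm_gradient] using h1

/-- Hardy's inequality for the difference of an element of `D^{1,2}` and a test function. -/
theorem Approx.eLpNorm_sub_div_norm_le (hN : 3 ≤ N) (h : Approx f u) (k : ℕ) :
    eLpNorm (fun x => f k x / ‖x‖ - u.toFun x / ‖x‖) 2 volume ≤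
      2 * eLpNorm (fun x => gradient (f k) x - u.grad x) 2 volume := by
  have hV : 3 ≤ Module.finrank ℝ (EuclideanSpace ℝ (Fin N)) := by simpa using hN
  obtain ⟨ns, hns, hae⟩ := (tendstoInMeasure_of_tendsto_eLpNorm
    (one_pos.trans_le (one_le_exponent hN)).ne'
    (fun k => (h.isTestFunction k).continuous.aestronglyMeasurable) u.memLp_toFun.1
    h.tendsto_toFun).exists_seq_tendsto_ae
  have hsub := fun i => (h.isTestFunction k).sub (h.isTestFunction (ns i))
  refine (Lp.eLpNorm_lim_le_liminf_eLpNorm (fun i => ((hsub i).memLp_div_norm hV).1) _ ?_).trans ?_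
  · filter_upwards [hae] with x hx
    rw [← sub_div]
    exact (hx.const_sub (f k x)).div_const _
  have hlim : Tendsto (fun i => 2 * (eLpNorm (fun x => gradient (f k) x - u.grad x) 2 volume +
      eLpNorm (fun x => gradient (f (ns i)) x - u.grad x) 2 volume)) atTop
      (𝓝 (2 * eLpNorm (fun x => gradient (f k) x - u.grad x) 2 volume)) := by
    have h1 := tendsto_const_nhds (x := eLpNorm (fun x => gradient (f k) x - u.grad x) 2 volume)
      |>.add (h.tendsto_grad.comp hns.tendsto_atTop)
    rw [add_zero] at h1
    exact ENNReal.Tendsto.const_mul h1 (Or.inr (by simp))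
  rw [← hlim.liminf_eq]
  refine liminf_le_liminf (Eventually.of_forall fun i => ?_)
  refine ((hsub i).eLpNorm_div_norm_le hV).trans ?_
  gcongr
  have e : eLpNorm (fderiv ℝ (fun x => f k x - f (ns i) x)) 2 volume =
      eLpNorm ((fun x => gradient (f k) x - u.grad x) -
        (fun x => gradient (f (ns i)) x - u.grad x)) 2 volume := by
    refine eLpNorm_congr_norm_ae (Eventually.of_forall fun x => ?_)
    rw [← norm_gradient, (h.isTestFunction k).gradient_sub (h.isTestFunction _)]
    simp
  rw [e]
  exact eLpNorm_sub_le (((h.isTestFunction k).memLp_gradient 2).sub u.memLp_grad).1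
    (((h.isTestFunction (ns i)).memLp_gradient 2).sub u.memLp_grad).1 (by norm_num)

theorem Approx.tendsto_testForm (hN : 3 ≤ N) (h : Approx f u)
    {m : EuclideanSpace ℝ (Fin N) → ℝ} (hm : MemLp m ∞ volume) :
    Tendsto (fun k => testForm m (f k)) atTop (𝓝 (hardyForm m u)) := by
  have hV : 3 ≤ Module.finrank ℝ (EuclideanSpace ℝ (Fin N)) := by simpa using hN
  have hf := fun k => (h.isTestFunction k).memLp_div_norm hV
  have hd : ∀ k, MemLp (fun x => f k x / ‖x‖ - u.toFun x / ‖x‖) 2 volume := fun k => by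
    refine ⟨(hf k).1.sub (u.memLp_toFun.1.aemeasurable.div
      measurable_norm.aemeasurable).aestronglyMeasurable, ?_⟩
    exact (h.eLpNorm_sub_div_norm_le hN k).trans_lt (ENNReal.mul_lt_top (by simp)
      (((h.isTestFunction k).memLp_gradient 2).sub u.memLp_grad).eLpNorm_lt_top)
  have hu : MemLp (fun x => u.toFun x / ‖x‖) 2 volume := by
    have := (hf 0).sub (hd 0)
    refine this.ae_eq (Eventually.of_forall fun x => ?_)
    simp
  have hlim : Tendsto (fun k => 2 * eLpNorm (fun x => gradient (f k) x - u.grad x) 2 volume)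
      atTop (𝓝 0) := by
    simpa using ENNReal.Tendsto.const_mul h.tendsto_grad (a := 2) (Or.inr (by simp))
  have h1 := tendsto_integral_mul_sq hm hf hu (tendsto_of_tendsto_of_tendsto_of_le_of_le
    tendsto_const_nhds hlim (fun _ => zero_le) fun k => h.eLpNorm_sub_div_norm_le hN k)
  have e : hardyForm m u = ∫ x, m x * (u.toFun x / ‖x‖) ^ 2 := by
    unfold hardyForm
    congr 1; funext x; ring
  simp only [testForm_eq, e]
  exact h1

/-- Test functions that are Cauchy for the Dirichlet energy converge in `D^{1,2}`: the functions
themselves are Cauchy in `L^{2*}` by the Sobolev inequality. -/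
theorem exists_approx_of_cauchy (hN : 3 ≤ N) (hf : ∀ k, IsTestFunction (f k))
    (hc : Tendsto (fun n : ℕ × ℕ => testEnergy (fun x => f n.1 x - f n.2 x)) atTop (𝓝 0)) :
    ∃ u : D12 N, Approx f u := by
  have hNR : (3 : ℝ) ≤ N := by exact_mod_cast hN
  have hsub := fun n : ℕ × ℕ => (hf n.1).sub (hf n.2)
  have hD : Tendsto (fun n : ℕ × ℕ => eLpNorm (fderiv ℝ (fun x => f n.1 x - f n.2 x)) 2 volume)
      atTop (𝓝 0) := by
    have h1 : ∀ n : ℕ × ℕ, eLpNorm (fderiv ℝ (fun x => f n.1 x - f n.2 x)) 2 volume =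
        ENNReal.ofReal √(testEnergy (fun x => f n.1 x - f n.2 x)) := fun n =>
      ((hsub n).memLp_fderiv 2).eLpNorm_two_eq_ofReal_sqrt
    simp_rw [h1]
    simpa [Function.comp_def] using (ENNReal.continuous_ofReal.tendsto _).comp hc.sqrt
  have hgrad : Tendsto (fun n : ℕ × ℕ => eLpNorm (gradient (f n.1) - gradient (f n.2)) 2 volume)
      atTop (𝓝 0) := by
    refine hD.congr fun n => eLpNorm_congr_norm_ae (Eventually.of_forall fun x => ?_)
    rw [← norm_gradient, (hf n.1).gradient_sub (hf n.2), Pi.sub_apply]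
  have hfun : Tendsto (fun n : ℕ × ℕ => eLpNorm (f n.1 - f n.2)
      (ENNReal.ofReal (2 * (N : ℝ) / ((N : ℝ) - 2))) volume) atTop (𝓝 0) := by
    set p' : NNReal := Real.toNNReal (2 * (N : ℝ) / ((N : ℝ) - 2))
    have hp' : (p' : ℝ)⁻¹ = ((2 : NNReal) : ℝ)⁻¹ -
        (Module.finrank ℝ (EuclideanSpace ℝ (Fin N)) : ℝ)⁻¹ := by
      have h2 : (N : ℝ) - 2 ≠ 0 := by linarith
      have h0 : (N : ℝ) ≠ 0 := by linarith
      rw [Real.coe_toNNReal _ (div_nonneg (by linarith) (by linarith)), finrank_euclideanSpace_fin]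
      push_cast
      field_simp
    have hsob : ∀ n : ℕ × ℕ, eLpNorm (f n.1 - f n.2) p' volume ≤
        eLpNormLESNormFDerivOfEqInnerConst
            (volume : Measure (EuclideanSpace ℝ (Fin N))) (2 : NNReal) *
          eLpNorm (fderiv ℝ (fun x => f n.1 x - f n.2 x)) 2 volume := fun n =>
      eLpNorm_le_eLpNorm_fderiv_of_eq_inner volume ((hsub n).contDiff.of_le (by simp))
        (hsub n).hasCompactSupport (by norm_num) (by rw [finrank_euclideanSpace_fin]; omega) hp'
    refine tendsto_of_tendsto_of_tendsto_of_le_of_le tendsto_const_nhds ?_ (fun _ => zero_le) hsob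
    simpa using ENNReal.Tendsto.const_mul hD (Or.inr ENNReal.coe_ne_top)
  obtain ⟨g, hg, hgl⟩ := exists_memLp_tendsto_of_cauchy (one_le_exponent hN)
    (fun k => (hf k).memLp _) hfun
  obtain ⟨G, hG, hGl⟩ := exists_memLp_tendsto_of_cauchy (by norm_num)
    (fun k => (hf k).memLp_gradient 2) hgrad
  exact ⟨⟨g, G, hg, hG, f, fun k => ⟨(hf k).contDiff, (hf k).hasCompactSupport⟩, hgl, hGl⟩,
    hf, hgl, hGl⟩

end D12

/-! ### The infimum and its attainment -/

section Infimum

variable {N : ℕ} {m : EuclideanSpace ℝ (Fin N) → ℝ}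

theorem hardyInf_nonneg (m : EuclideanSpace ℝ (Fin N) → ℝ) : 0 ≤ hardyInf m := by
  refine le_iInf₂ fun u hu => ?_
  have : 0 ≤ dirichletEnergy u / hardyForm m u :=
    div_nonneg (integral_nonneg fun _ => by positivity) hu.le
  exact_mod_cast this

/-- The defining inequality of `hardyInf`, without division and for test functions of either sign of
the form. -/
theorem IsTestFunction.mul_testForm_le {φ : EuclideanSpace ℝ (Fin N) → ℝ}
    (hφ : IsTestFunction φ) {t : ℝ} (ht : 0 ≤ t) (htm : (t : EReal) ≤ hardyInf m) :
    t * testForm m φ ≤ testEnergy φ := by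
  rcases le_or_gt (testForm m φ) 0 with h | h
  · exact (mul_nonpos_of_nonneg_of_nonpos ht h).trans (testEnergy_nonneg φ)
  · have h1 : hardyInf m ≤ _ := iInf₂_le (D12.ofTest hφ) h
    have h2 := htm.trans h1
    rw [D12.dirichletEnergy_ofTest, D12.hardyForm_ofTest, EReal.coe_le_coe_iff,
      le_div_iff₀ h] at h2
    exact h2

/-- The infimum is approached by test functions. -/
theorem exists_minimizing_sequence (hN : 3 ≤ N) (hm : MemLp m ∞ volume) {lam : ℝ}
    (hlam0 : 0 ≤ lam) (hlam : hardyInf m = lam) :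
    ∃ f : ℕ → EuclideanSpace ℝ (Fin N) → ℝ, (∀ k, IsTestFunction (f k)) ∧
      (∀ k, testForm m (f k) = 1) ∧ Tendsto (fun k => testEnergy (f k)) atTop (𝓝 lam) := by
  have hex : ∀ k : ℕ, ∃ φ : EuclideanSpace ℝ (Fin N) → ℝ, IsTestFunction φ ∧
      testForm m φ = 1 ∧ testEnergy φ < lam + 1 / ((k : ℝ) + 1) := fun k => by
    have hk : 0 < 1 / ((k : ℝ) + 1) := by positivity
    have hlt : hardyInf m < ((lam + 1 / ((k : ℝ) + 1) : ℝ) : EReal) := by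
      rw [hlam, EReal.coe_lt_coe_iff]
      linarith
    unfold hardyInf at hlt
    simp only [iInf_lt_iff] at hlt
    obtain ⟨u, hu, hlt⟩ := hlt
    rw [EReal.coe_lt_coe_iff] at hlt
    obtain ⟨g, hg⟩ := u.exists_approx'
    have hB := hg.tendsto_testForm hN hm
    have hE := hg.tendsto_testEnergy
    obtain ⟨i, hi, hi'⟩ := ((hB.eventually (lt_mem_nhds hu)).and
      ((hE.div hB hu.ne').eventually (gt_mem_nhds hlt))).exists
    have hc : (1 / √(testForm m (g i))) ^ 2 = 1 / testForm m (g i) := by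
      rw [div_pow, Real.sq_sqrt hi.le, one_pow]
    refine ⟨_, (hg.isTestFunction i).const_mul (1 / √(testForm m (g i))), ?_, ?_⟩
    · rw [testForm_const_mul, hc, one_div_mul_cancel hi.ne']
    · rw [(hg.isTestFunction i).testEnergy_const_mul, hc, one_div_mul_eq_div]
      exact hi'
  choose f hf hf1 hfE using hex
  refine ⟨f, hf, hf1, ?_⟩
  have hup : Tendsto (fun k : ℕ => lam + 1 / ((k : ℝ) + 1)) atTop (𝓝 lam) := by
    simpa using tendsto_one_div_add_atTop_nhds_zero_nat.const_add lam
  refine tendsto_of_tendsto_of_tendsto_of_le_of_le tendsto_const_nhds hup (fun k => ?_)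
    fun k => (hfE k).le
  have := (hf k).mul_testForm_le hlam0 hlam.ge
  rwa [hf1, mul_one] at this

end Infimum

theorem theorem2p2 (N : ℕ) (hN : 3 ≤ N)
    (m mPlus mMinus : EuclideanSpace ℝ (Fin N) → ℝ) (γPlus γMinus : ℝ)
    (hγPlus : 1 < γPlus) (hγMinus : 1 < γMinus)
    (hm : MemLp m ∞ volume)
    (hPlus : ∀ᵐ x, Tendsto (fun j : ℕ => m (γPlus ^ j • x)) atTop (𝓝 (mPlus x)))
    (hMinus : ∀ᵐ x, Tendsto (fun j : ℕ => m ((γMinus ^ j)⁻¹ • x)) atTop (𝓝 (mMinus x)))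
    (hPlusUnif : ∀ R : ℝ, 0 < R → ∀ ε : ℝ, 0 < ε → ∀ᶠ j : ℕ in atTop,
      ∀ᵐ x, R ≤ ‖x‖ → |m (γPlus ^ j • x) - mPlus x| ≤ ε)
    (hMinusUnif : ∀ ρ : ℝ, 0 < ρ → ∀ ε : ℝ, 0 < ε → ∀ᶠ j : ℕ in atTop,
      ∀ᵐ x, ‖x‖ ≤ ρ → |m ((γMinus ^ j)⁻¹ • x) - mMinus x| ≤ ε)
    (hlt : hardyInf m < min (hardyInf mPlus) (hardyInf mMinus)) :
    ∃ u : D12 N, 0 < hardyForm m u ∧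
      ((dirichletEnergy u / hardyForm m u : ℝ) : EReal) = hardyInf m := by
  have hV : 3 ≤ Module.finrank ℝ (EuclideanSpace ℝ (Fin N)) := by simpa using hN
  have hγP : 0 < γPlus := by linarith
  have hγM : 0 < γMinus := by linarith
  simp only [← inv_pow] at hMinus hMinusUnif
  have hmP := memLp_top_of_tendsto_dilation hγP.ne' hm hPlus
  have hmM := memLp_top_of_tendsto_dilation (inv_pos.2 hγM).ne' hm hMinus
  have hinf : ∀ ε : ℝ, 0 < ε → ∃ R : ℝ, 0 < R ∧ ∀ᵐ x, R ≤ ‖x‖ → |m x - mPlus x| ≤ ε := by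
    intro ε hε
    obtain ⟨j, hj⟩ := (hPlusUnif 1 one_pos ε hε).exists
    have hγj : 0 < γPlus ^ j := pow_pos hγP j
    refine ⟨γPlus ^ j, hγj, ?_⟩
    filter_upwards [ae_abs_sub_le_of_dilation hγP.ne' hPlus hj] with x hx hR
    refine hx ?_
    rw [norm_smul, norm_inv, Real.norm_of_nonneg hγj.le, inv_mul_eq_div, le_div_iff₀ hγj, one_mul]
    exact hR
  have hzero : ∀ ε : ℝ, 0 < ε → ∃ r : ℝ, 0 < r ∧ ∀ᵐ x, ‖x‖ ≤ r → |m x - mMinus x| ≤ ε := by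
    intro ε hε
    obtain ⟨j, hj⟩ := (hMinusUnif 1 one_pos ε hε).exists
    have hγj : 0 < γMinus⁻¹ ^ j := pow_pos (inv_pos.2 hγM) j
    refine ⟨γMinus⁻¹ ^ j, hγj, ?_⟩
    filter_upwards [ae_abs_sub_le_of_dilation (inv_pos.2 hγM).ne' hMinus hj] with x hx hr
    refine hx ?_
    rw [norm_smul, norm_inv, Real.norm_of_nonneg hγj.le, inv_mul_eq_div, div_le_iff₀ hγj, one_mul]
    exact hr
  obtain ⟨t, hmt, ht⟩ := EReal.lt_iff_exists_real_btwn.1 hlt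
  obtain ⟨lam, hlam⟩ : ∃ lam : ℝ, hardyInf m = lam :=
    ⟨_, (EReal.coe_toReal (hmt.trans (EReal.coe_lt_top t)).ne
      (EReal.bot_lt_zero.trans_le (hardyInf_nonneg m)).ne').symm⟩
  have hlam0 : 0 ≤ lam := by
    have := hardyInf_nonneg m
    rw [hlam] at this
    exact_mod_cast this
  have hlamt : lam < t := by
    rw [hlam] at hmt
    exact_mod_cast hmt
  have ht0 : 0 ≤ t := hlam0.trans hlamt.le
  obtain ⟨f, hf, hf1, hfE⟩ := exists_minimizing_sequence hN hm hlam0 hlam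
  obtain ⟨ns, hns, hcauchy⟩ := exists_subseq_testEnergy_cauchy hV hm hlam0 hlamt
    (fun φ hφ => hφ.mul_testForm_le hlam0 hlam.ge)
    (fun δ hδ => exists_mul_testForm_le hV hm hmM hmP hzero hinf ht0
      (fun φ hφ => hφ.mul_testForm_le ht0 (ht.le.trans (min_le_right _ _)))
      (fun φ hφ => hφ.mul_testForm_le ht0 (ht.le.trans (min_le_left _ _))) hδ) hf hf1 hfE
  obtain ⟨u, hu⟩ := D12.exists_approx_of_cauchy hN (fun k => hf (ns k)) hcauchy
  have hB : hardyForm m u = 1 := by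
    refine tendsto_nhds_unique (hu.tendsto_testForm hN hm) ?_
    simp only [hf1]
    exact tendsto_const_nhds
  have hE : dirichletEnergy u = lam :=
    tendsto_nhds_unique hu.tendsto_testEnergy (hfE.comp hns.tendsto_atTop)
  refine ⟨u, by rw [hB]; exact one_pos, ?_⟩
  rw [hB, hE, div_one, hlam]
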